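/- All graphs are finite and simple. A proper dynamic $k$-coloring of a graph $G$ is a surjective map $c:V(G)\to\{1,\dots,k\}$ such that $c(u)\neq c(v)$ for adjacent $u,v$, and $|c(N_G(v))|\ge \min\{d(v),2\}$ for every vertex $v$; the dynamic chromatic number $\chi_d(G)$ is the smallest $k$ for which such a coloring exists. For $i\ge 2$, an $A_i$ of $G$ is a path in $G$ with $i$ vertices (not necessarily induced) whose two end-vertices have degree $3$ in $G$ and whose $i-2$ internal vertices have degree $2$ in $G$. Let $\mathscr{C}$ be the class of graphs $G$ with maximum degree $\Delta(G)\le 3$ that are claw-free (contain no induced $K_{1,3}$) and contain no $A_i$ with $i=3j+1$ for any integer $j\ge 1$. **Theorem.** The problem of deciding, for a given graph $G\in\mathscr{C}$, whether $G$ is dynamically $3$-colorable, i.e. whether $\chi_d(G)\le 3$, is solvable in polynomial time. That is, there are a Turing machine and a polynomial $q$ such that, for every $G\in\mathscr{C}$, the machine started on the adjacency matrix of $G$ halts with the correct answer after at most $q(\ell)$ steps, where $\ell$ is the length of the input. -/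

import Mathlib

/-- The claw `K_{1,3}` is not an induced subgraph of `G`. -/
def IsClawFree {V : Type} (G : SimpleGraph V) : Prop :=
  ¬ (completeBipartiteGraph (Fin 1) (Fin 3)).IsIndContained G

open Classical in
/-- The path `p` of `G` is an `A_i`: it has `i` vertices, its two end-vertices have degree `3` in
`G`, and all its internal vertices have degree `2` in `G`. (Here `p` is a path in `G`, not
necessarily an induced one.) -/
def IsA {V : Type} [Fintype V] (G : SimpleGraph V) (i : ℕ) {u v : V} (p : G.Walk u v) : Prop :=
  p.IsPath ∧ p.support.length = i ∧ G.degree u = 3 ∧ G.degree v = 3 ∧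
    ∀ w ∈ p.support, w ≠ u → w ≠ v → G.degree w = 2

/-- `G` contains no `A_i`. -/
def IsAFree {V : Type} [Fintype V] (G : SimpleGraph V) (i : ℕ) : Prop :=
  ∀ (u v : V) (p : G.Walk u v), ¬ IsA G i p

open Classical in
/-- The class of finite graphs of maximum degree at most `3` that are claw-free and `A_i`-free for
every `i = 3j + 1` with `j` a positive integer. -/
def InClassC {V : Type} [Fintype V] (G : SimpleGraph V) : Prop :=
  G.maxDegree ≤ 3 ∧ IsClawFree G ∧ ∀ j : ℕ, 1 ≤ j → IsAFree G (3 * j + 1)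

open Classical in
/-- `c` is a proper dynamic `k`-coloring of `G`: a surjective map onto the `k` colors such that
adjacent vertices get different colors and `|c(N(v))| ≥ min {d(v), 2}` for every vertex `v`. -/
def IsDynamicColoring {V : Type} [Fintype V] (G : SimpleGraph V) {k : ℕ} (c : V → Fin k) : Prop :=
  Function.Surjective c ∧ (∀ u v : V, G.Adj u v → c u ≠ c v) ∧
    ∀ v : V, min (G.degree v) 2 ≤ (c '' G.neighborSet v).ncard

/-- The dynamic chromatic number: the least `k` for which `G` has a proper dynamic `k`-coloring.
Such `k` exist (give all vertices different colors), and `k = 0` occurs only for the graph without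
vertices. -/
noncomputable def dynamicChromaticNumber {V : Type} [Fintype V] (G : SimpleGraph V) : ℕ :=
  sInf {k : ℕ | ∃ c : V → Fin k, IsDynamicColoring G c}

/-- An input graph: a simple graph whose vertices are labelled `0, …, n - 1`. -/
abbrev LabelledGraph : Type := Σ n : ℕ, SimpleGraph (Fin n)

open Classical in
/-- The adjacency matrix, written row by row as a word over the three-letter alphabet
`Option Bool`: `some true` and `some false` are the entries `1` and `0`, and `none` marks the end
of a row. -/
noncomputable def encodeGraph (G : LabelledGraph) : List (Option Bool) :=
  (List.finRange G.1).flatMap fun i =>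
    (List.finRange G.1).map (fun j => some (decide (G.2.Adj i j))) ++ [none]

/-- The decision problem given by the question `Q`, with inputs restricted to the graphs that
satisfy `P`, is solvable in polynomial time: some Turing machine, on the adjacency matrix of any
graph with property `P`, halts after a number of steps bounded by a polynomial in the length of
the input, with the correct answer to `Q` as its output. -/
def PolynomiallySolvableOn (P Q : LabelledGraph → Prop) : Prop :=
  ∃ answer : {G : LabelledGraph // P G} → Bool, (∀ G, answer G = true ↔ Q G.1) ∧
    Nonempty (Turing.TM2ComputableInPolyTime
      (fun G : {G : LabelledGraph // P G} => encodeGraph G.1) Computability.encodeBool answer)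

/-!
In a dynamic `3`-colouring, a vertex of degree two and its neighbours get three distinct colours.
Hence the colours along a walk through vertices of degree two are an arithmetic progression modulo
`3`, and if its ends are equal or opposite in a diamond, its length is divisible by three. For the
graphs of the class, this necessary condition is sufficient. Join the vertices of degree three that
are the ends of a path through vertices of degree two. In the resulting graph, a vertex of degree
three lies in a triangle and there is no `K₄`; vertices of smaller degree can be coloured last, and
the others form triangles joined by a matching. This gives a `3`-colouring, and each path is then
directed so that the colours along it increase by one modulo `3`. The direction fits the colours of
the ends, since no path has length divisible by three when there is no `A_i` with `i = 3j + 1`.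

The condition is first-order over adjacency and the reachability relation of a functional step on
ordered pairs of vertices. Both are decided in polynomial time with a bounded number of counters
that store vertices, and a Turing machine with one stack per counter simulates such a program.
-/

section CounterPrograms

open Turing StateTransition Function

/-- The conditions on which counter programs branch: the flag is set, the counter `i` is positive,
the symbol under the head (`none` at the right end of the input) satisfies `b`. -/
inductive CounterTest (α : Type) : Type
  | flag
  | counter (i : ℕ)
  | symbol (b : Option α → Bool)

/-- Structured programs for a machine with a two-way read-only input head, one Boolean flag and
counters indexed by `ℕ`. -/
inductive CounterProg (α : Type) : Type
  | inc (i : ℕ)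
  | dec (i : ℕ)
  | left
  | right
  | setFlag (b : Bool)
  | seq (p q : CounterProg α)
  | ite (t : CounterTest α) (p q : CounterProg α)
  | loop (t : CounterTest α) (p : CounterProg α)

/-- The state of a counter program, apart from its input. -/
structure CounterState : Type where
  flag : Bool
  head : ℕ
  count : ℕ → ℕ

/-- The truth value of a test in a state, on the input `w`. -/
def CounterTest.eval {α : Type} (w : List α) : CounterTest α → CounterState → Bool
  | flag, s => s.flag
  | counter i, s => decide (0 < s.count i)
  | symbol b, s => b w[s.head]?

/-- The counter named in a test. -/
def CounterTest.maxCounter {α : Type} : CounterTest α → ℕ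
  | counter i => i
  | _ => 0

namespace CounterProg

section Machine

variable {α : Type}

/-- `Runs w p s s' t`: on the input `w`, the program `p` takes the state `s` to `s'` in at most `t`
steps. The head has to stay between the two ends of the input. -/
inductive Runs (w : List α) : CounterProg α → CounterState → CounterState → ℕ → Prop
  | mono {p s s' t t'} (h : Runs w p s s' t) (ht : t ≤ t') : Runs w p s s' t'
  | inc (i b h x) : Runs w (inc i) ⟨b, h, x⟩ ⟨b, h, update x i (x i + 1)⟩ 1
  | dec (i b h x) : Runs w (dec i) ⟨b, h, x⟩ ⟨b, h, update x i (x i - 1)⟩ 1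
  | left {b h x} (hh : h < w.length) : Runs w left ⟨b, h + 1, x⟩ ⟨b, h, x⟩ 1
  | right {b h x} (hh : h < w.length) : Runs w right ⟨b, h, x⟩ ⟨b, h + 1, x⟩ 1
  | setFlag (b b' h x) : Runs w (setFlag b) ⟨b', h, x⟩ ⟨b, h, x⟩ 1
  | seq {p q s s' s'' t t'} (h : Runs w p s s' t) (h' : Runs w q s' s'' t') :
      Runs w (seq p q) s s'' (t + t')
  | ite_true {c p q s s' t} (hc : c.eval w s = true) (h : Runs w p s s' t) :
      Runs w (ite c p q) s s' (1 + t)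
  | ite_false {c p q s s' t} (hc : c.eval w s = false) (h : Runs w q s s' t) :
      Runs w (ite c p q) s s' (1 + t)
  | loop_false {c p s} (hc : c.eval w s = false) : Runs w (loop c p) s s 1
  | loop_true {c p s s' s'' t t'} (hc : c.eval w s = true) (h : Runs w p s s' t)
      (h' : Runs w (loop c p) s' s'' t') : Runs w (loop c p) s s'' (1 + t + t')

/-- The stacks of the Turing machine that simulates programs with the counters `0, …, N`: the input
on the two sides of the head, the counters in unary, and the output. -/
inductive Stack (N : ℕ) : Type
  | left
  | right
  | counter (i : Fin (N + 1))
  | out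
  deriving DecidableEq, Fintype

/-- The stack alphabets. -/
abbrev Stack.Alphabet (α : Type) {N : ℕ} : Stack N → Type
  | out => Bool
  | _ => α

/-- The statements of the machine. Its memory holds the flag and, within a statement, the symbol
read last. -/
abbrev Stmt (α Λ : Type) (N : ℕ) : Type :=
  TM2.Stmt (Stack.Alphabet α (N := N)) Λ (Bool × Option α)

/-- Branching on the symbol read last, which is then discarded. -/
def branchRead {Λ : Type} {N : ℕ} (b : Option α → Bool) (q r : Stmt α Λ N) : Stmt α Λ N :=
  .branch (fun v => b v.2) (.load (fun v => (v.1, none)) q) (.load (fun v => (v.1, none)) r)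

/-- Branching on a test. -/
def branch {Λ : Type} {N : ℕ} (q r : Stmt α Λ N) : CounterTest α → Stmt α Λ N
  | .flag => .branch Prod.fst q r
  | .counter i =>
    .peek (.counter (.clamp i N)) (fun v a => (v.1, a)) (branchRead Option.isSome q r)
  | .symbol b => .peek .right (fun v a => (v.1, a)) (branchRead b q r)

/-- The points of a program: its instructions and tests. -/
def Point : CounterProg α → Type
  | seq p q => p.Point ⊕ q.Point
  | ite _ p q => Option (p.Point ⊕ q.Point)
  | loop _ p => Option p.Point
  | _ => Unit

instance finite_point (p : CounterProg α) : Finite p.Point := by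
  induction p with
  | seq p q hp hq => exact inferInstanceAs (Finite (p.Point ⊕ q.Point))
  | ite t p q hp hq => exact inferInstanceAs (Finite (Option (p.Point ⊕ q.Point)))
  | loop t p hp => exact inferInstanceAs (Finite (Option p.Point))
  | _ => exact inferInstanceAs (Finite Unit)

/-- The point at which the execution of a program starts. -/
def entry : (p : CounterProg α) → p.Point
  | seq p _ => Sum.inl p.entry
  | ite _ _ _ | loop _ _ => none
  | inc _ | dec _ | left | right | setFlag _ => ()

/-- The largest counter named in a program. -/
def maxCounter : CounterProg α → ℕ
  | inc i | dec i => i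
  | seq p q => max p.maxCounter q.maxCounter
  | ite c p q => max c.maxCounter (max p.maxCounter q.maxCounter)
  | loop c p => max c.maxCounter p.maxCounter
  | _ => 0

theorem reverse_take_succ {w : List α} {h : ℕ} (hh : h < w.length) :
    (w.take (h + 1)).reverse = w[h] :: (w.take h).reverse := by
  rw [List.take_succ_eq_append_getElem hh, List.reverse_append]
  rfl

variable [Inhabited α] {Λ : Type} {N : ℕ}

/-- The statement executed at a point of a program. The points of the program are embedded in the
labels of the machine by `e`, and control passes to the label `l` when the program ends. -/
def compile : (p : CounterProg α) → (p.Point → Λ) → Λ → p.Point → Stmt α Λ N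
  | inc i, _, l, _ => .push (.counter (.clamp i N)) (fun _ => default) (.goto fun _ => l)
  | dec i, _, l, _ => .pop (.counter (.clamp i N)) (fun v _ => v) (.goto fun _ => l)
  | left, _, l, _ =>
      .pop .left (fun v a => (v.1, a)) <| .push .right (fun v => v.2.getD default) <|
        .load (fun v => (v.1, none)) <| .goto fun _ => l
  | right, _, l, _ =>
      .pop .right (fun v a => (v.1, a)) <| .push .left (fun v => v.2.getD default) <|
        .load (fun v => (v.1, none)) <| .goto fun _ => l
  | setFlag b, _, l, _ => .load (fun v => (b, v.2)) (.goto fun _ => l)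
  | seq p q, e, _, .inl x => p.compile (fun y => e (.inl y)) (e (.inr q.entry)) x
  | seq _ q, e, l, .inr x => q.compile (fun y => e (.inr y)) l x
  | ite c p q, e, _, none =>
      branch (.goto fun _ => e (some (.inl p.entry))) (.goto fun _ => e (some (.inr q.entry))) c
  | ite _ p _, e, l, some (.inl x) => p.compile (fun y => e (some (.inl y))) l x
  | ite _ _ q, e, l, some (.inr x) => q.compile (fun y => e (some (.inr y))) l x
  | loop c p, e, l, none => branch (.goto fun _ => e (some p.entry)) (.goto fun _ => l) c
  | loop _ p, e, _, some x => p.compile (fun y => e (some y)) (e none) x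

/-- The contents of the stacks in a state of a counter program. -/
def contents (w : List α) (s : CounterState) : ∀ k : Stack N, List (k.Alphabet α)
  | .left => (w.take s.head).reverse
  | .right => w.drop s.head
  | .counter i => List.replicate (s.count i) default
  | .out => []

/-- The configuration of the machine in a state of a counter program. -/
def config (w : List α) (l : Λ) (s : CounterState) :
    TM2.Cfg (Stack.Alphabet α (N := N)) Λ (Bool × Option α) :=
  ⟨some l, (s.flag, none), contents w s⟩

theorem contents_update_count (w : List α) (b : Bool) (h : ℕ) (x : ℕ → ℕ) {i : ℕ} (hi : i ≤ N)
    (m : ℕ) : contents (N := N) w ⟨b, h, update x i m⟩ =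
      update (contents w ⟨b, h, x⟩) (.counter (.clamp i N)) (List.replicate m default) := by
  funext k
  rcases k with _ | _ | j | _ <;> try rfl
  by_cases hj : (j : ℕ) = i
  · obtain rfl : j = .clamp i N := Fin.ext (by simpa [hi] using hj)
    simp [contents, hi]
  · have : j ≠ .clamp i N := fun h => hj (by simp [h, hi])
    simp [contents, hj, this]

theorem contents_succ {w : List α} {h : ℕ} (hh : h < w.length) (b : Bool) (x : ℕ → ℕ) :
    contents (N := N) w ⟨b, h + 1, x⟩ = update (update (contents w ⟨b, h, x⟩)
      .right (w.drop (h + 1))) .left (w[h] :: (w.take h).reverse) := by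
  funext k
  rcases k with _ | _ | j | _ <;> simp [contents, reverse_take_succ hh]

theorem contents_of_succ {w : List α} {h : ℕ} (hh : h < w.length) (b : Bool) (x : ℕ → ℕ) :
    contents (N := N) w ⟨b, h, x⟩ = update (update (contents w ⟨b, h + 1, x⟩)
      .left (w.take h).reverse) .right (w[h] :: w.drop (h + 1)) := by
  funext k
  rcases k with _ | _ | j | _ <;> simp [contents]

theorem stepAux_branch {w : List α} {s : CounterState} {c : CounterTest α} (hc : c.maxCounter ≤ N)
    (l l' : Λ) :
    TM2.stepAux (branch (.goto fun _ => l) (.goto fun _ => l') c) (s.flag, none) (contents w s) =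
      config (N := N) w (if c.eval w s then l else l') s := by
  cases c with
  | flag => cases h : s.flag <;> simp [branch, CounterTest.eval, config, h]
  | counter i =>
    have hi : min i N = i := min_eq_left hc
    cases h : s.count i <;>
      simp [branch, branchRead, CounterTest.eval, config, contents, hi, h, List.replicate_succ]
  | symbol b =>
    cases h : b w[s.head]? <;>
      simp [branch, branchRead, CounterTest.eval, config, contents, h]

section Simulation

variable {M : Λ → Stmt α Λ N} {w : List α} {l l' l'' : Λ} {s s' s'' : CounterState} {t t' : ℕ}

/-- The machine with statements `M` simulates a run of length `t` between two states, starting at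
the label `l` and ending at `l'`. -/
def Simulates (M : Λ → Stmt α Λ N) (w : List α) (l l' : Λ) (s s' : CounterState) (t : ℕ) : Prop :=
  Nonempty (EvalsToInTime (TM2.step M) (config w l s) (some (config w l' s')) t)

theorem Simulates.mono (h : Simulates M w l l' s s' t) (ht : t ≤ t') :
    Simulates M w l l' s s' t' :=
  h.map fun ⟨e, he⟩ => ⟨e, he.trans ht⟩

theorem Simulates.trans (h : Simulates M w l l' s s' t) (h' : Simulates M w l' l'' s' s'' t') :
    Simulates M w l l'' s s'' (t + t') := by
  obtain ⟨h⟩ := h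
  obtain ⟨h'⟩ := h'
  exact add_comm t t' ▸ ⟨h.trans _ _ _ _ _ _ h'⟩

theorem Simulates.step
    (h : TM2.stepAux (M l) (s.flag, none) (contents w s) = config w l' s') :
    Simulates M w l l' s s' 1 :=
  ⟨⟨⟨1, congrArg some h⟩, le_rfl⟩⟩

theorem simulates_inc {i : ℕ} (hi : i ≤ N) (b : Bool) (h : ℕ) (x : ℕ → ℕ)
    {e : (inc (α := α) i).Point → Λ} (hM : M l = (inc i).compile e l' (entry _)) :
    Simulates M w l l' ⟨b, h, x⟩ ⟨b, h, update x i (x i + 1)⟩ 1 := by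
  refine .step ?_
  rw [hM, config, contents_update_count w b h x hi]
  simp [compile, contents, hi, List.replicate_succ]

theorem simulates_dec {i : ℕ} (hi : i ≤ N) (b : Bool) (h : ℕ) (x : ℕ → ℕ)
    {e : (dec (α := α) i).Point → Λ} (hM : M l = (dec i).compile e l' (entry _)) :
    Simulates M w l l' ⟨b, h, x⟩ ⟨b, h, update x i (x i - 1)⟩ 1 := by
  refine .step ?_
  rw [hM, config, contents_update_count w b h x hi]
  simp [compile, contents, hi]

theorem simulates_left {h : ℕ} (hh : h < w.length) (b : Bool) (x : ℕ → ℕ)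
    {e : (left (α := α)).Point → Λ} (hM : M l = left.compile e l' (entry _)) :
    Simulates M w l l' ⟨b, h + 1, x⟩ ⟨b, h, x⟩ 1 := by
  refine .step ?_
  rw [hM, config, contents_of_succ hh]
  simp [compile, contents, reverse_take_succ hh]

theorem simulates_right {h : ℕ} (hh : h < w.length) (b : Bool) (x : ℕ → ℕ)
    {e : (right (α := α)).Point → Λ} (hM : M l = right.compile e l' (entry _)) :
    Simulates M w l l' ⟨b, h, x⟩ ⟨b, h + 1, x⟩ 1 := by
  refine .step ?_
  rw [hM, config, contents_succ hh]
  simp [compile, contents, hh]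

theorem simulates_branch_true {c : CounterTest α} (hc : c.maxCounter ≤ N)
    (hM : M l = branch (.goto fun _ => l') (.goto fun _ => l'') c) (h : c.eval w s = true) :
    Simulates M w l l' s s 1 :=
  .step (hM ▸ (stepAux_branch hc l' l'').trans (by rw [h, if_pos rfl]))

theorem simulates_branch_false {c : CounterTest α} (hc : c.maxCounter ≤ N)
    (hM : M l = branch (.goto fun _ => l') (.goto fun _ => l'') c) (h : c.eval w s = false) :
    Simulates M w l l'' s s 1 :=
  .step (hM ▸ (stepAux_branch hc l' l'').trans (by rw [h, if_neg Bool.false_ne_true]))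

theorem Runs.simulates {p : CounterProg α} (h : Runs w p s s' t) (hN : p.maxCounter ≤ N)
    {e : p.Point → Λ} (hM : ∀ x, M (e x) = p.compile e l x) :
    Simulates M w (e p.entry) l s s' t := by
  induction h generalizing l with
  | mono _ ht ih => exact (ih hN hM).mono ht
  | inc i b h x => exact simulates_inc hN b h x (hM _)
  | dec i b h x => exact simulates_dec hN b h x (hM _)
  | left hh => exact simulates_left hh _ _ (hM _)
  | right hh => exact simulates_right hh _ _ (hM _)
  | setFlag b b' h x => exact .step (hM _ ▸ rfl)
  | seq _ _ ih ih' =>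
    obtain ⟨hp, hq⟩ := max_le_iff.1 hN
    exact (ih hp fun x => hM (.inl x)).trans (ih' hq fun x => hM (.inr x))
  | ite_true hc _ ih =>
    obtain ⟨ht, hpq⟩ := max_le_iff.1 hN
    exact (simulates_branch_true ht (hM none) hc).trans
      (ih (max_le_iff.1 hpq).1 fun x => hM (some (.inl x)))
  | ite_false hc _ ih =>
    obtain ⟨ht, hpq⟩ := max_le_iff.1 hN
    exact (simulates_branch_false ht (hM none) hc).trans
      (ih (max_le_iff.1 hpq).2 fun x => hM (some (.inr x)))
  | loop_false hc => exact simulates_branch_false (max_le_iff.1 hN).1 (hM none) hc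
  | loop_true hc _ _ ih ih' =>
    obtain ⟨ht, hp⟩ := max_le_iff.1 hN
    exact ((simulates_branch_true ht (hM none) hc).trans (ih hp fun x => hM (some x))).trans
      (ih' hN hM)

end Simulation

/-- The statement at the end of a program: the machine empties its input stack and outputs the
flag. -/
def output : Stmt α (Option Λ) N :=
  .pop .right (fun v a => (v.1, a)) <| .branch (fun v => v.2.isSome) (.goto fun _ => none) <|
    .push .out (fun v => v.1) <| .load (fun _ => (false, none)) .halt

open Classical in
/-- The Turing machine that runs a program and outputs the flag. -/
noncomputable def machine [Fintype α] (p : CounterProg α) : FinTM2 where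
  K := Stack p.maxCounter
  k₀ := .right
  k₁ := .out
  Γ := Stack.Alphabet α
  Λ := Option p.Point
  main := some p.entry
  ΛFin := .ofFinite _
  σ := Bool × Option α
  initialState := (false, none)
  Γk₀Fin := inferInstanceAs (Fintype α)
  m
    | none => output
    | some x => p.compile some none x

theorem config_zero (w : List α) (l : Λ) (b : Bool) :
    config (N := N) w l ⟨b, 0, 0⟩ = ⟨some l, (b, none), update (fun _ => []) .right w⟩ := by
  refine congrArg (TM2.Cfg.mk _ _) (funext fun k => ?_)
  rcases k with _ | _ | i | _ <;> simp [contents]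

theorem initList_machine [Fintype α] (p : CounterProg α) (w : List α) :
    initList p.machine w = config w (some p.entry) ⟨false, 0, 0⟩ := by
  refine congrArg (TM2.Cfg.mk _ _) (funext fun k => ?_)
  rcases k with _ | _ | i | _ <;> rfl

theorem haltList_machine [Fintype α] (p : CounterProg α) (b : Bool) :
    haltList p.machine [b] = ⟨none, (false, none), update (fun _ => []) .out [b]⟩ := by
  refine congrArg (TM2.Cfg.mk _ _) (funext fun k => ?_)
  rcases k with _ | _ | i | _ <;> rfl

omit [Inhabited α] in
theorem nonempty_evalsToInTime_output {M : Option Λ → Stmt α (Option Λ) N} (hM : M none = output)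
    (b : Bool) (a : Option α) (w : List α) :
    Nonempty (EvalsToInTime (TM2.step M) ⟨some none, (b, a), update (fun _ => []) .right w⟩
      (some ⟨none, (false, none), update (fun _ => []) .out [b]⟩) (w.length + 1)) := by
  induction w generalizing a with
  | nil =>
    refine ⟨⟨⟨1, congrArg some ?_⟩, le_rfl⟩⟩
    simp [hM, output]
  | cons c w ih =>
    obtain ⟨h⟩ := ih (some c)
    refine ⟨EvalsToInTime.trans _ 1 _ _ _ _ ⟨⟨1, congrArg some ?_⟩, le_rfl⟩ h⟩
    simp [hM, output]

theorem Simulates.trans_output {M : Option Λ → Stmt α (Option Λ) N} (hM : M none = output)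
    {w : List α} {l : Option Λ} {s : CounterState} {b : Bool} {t : ℕ}
    (h : Simulates M w l none s ⟨b, 0, 0⟩ t) :
    Nonempty (EvalsToInTime (TM2.step M) (config w l s)
      (some ⟨none, (false, none), update (fun _ => []) .out [b]⟩) (w.length + 1 + t)) := by
  rw [Simulates, config_zero w none b] at h
  obtain ⟨h⟩ := h
  obtain ⟨hout⟩ := nonempty_evalsToInTime_output hM b none w
  exact ⟨h.trans _ _ _ _ _ _ hout⟩

theorem Runs.machine_outputs [Fintype α] {p : CounterProg α} {w : List α} {b : Bool} {t : ℕ}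
    (h : Runs w p ⟨false, 0, 0⟩ ⟨b, 0, 0⟩ t) :
    Nonempty (TM2OutputsInTime p.machine w (some [b]) (w.length + 1 + t)) := by
  have hsim : Simulates p.machine.m w (some p.entry) none _ _ t := h.simulates le_rfl fun _ => rfl
  obtain ⟨hout⟩ := hsim.trans_output rfl
  have heq := congrArg₂ (fun c c' => EvalsToInTime p.machine.step c (some c') (w.length + 1 + t))
    (initList_machine p w) (haltList_machine p b)
  exact ⟨cast heq.symm hout⟩

end Machine

section Loops

variable {α : Type} {w : List α} {b b' : Bool} {h h' i j m t u : ℕ}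
  {x x' y y' : ℕ → ℕ} {p q : CounterProg α} {T T' : ℕ}

theorem Runs.congr (hp : Runs w p ⟨b, h, x⟩ ⟨b', h', x'⟩ T) (hx : ∀ a, x a = y a)
    (hx' : ∀ a, x' a = y' a) (hT : T ≤ T') : Runs w p ⟨b, h, y⟩ ⟨b', h', y'⟩ T' :=
  funext hx ▸ funext hx' ▸ hp.mono hT

theorem Runs.loop {c : CounterTest α} (s : ℕ → CounterState)
    (hc : ∀ a < m, c.eval w (s a) = true) (hm : c.eval w (s m) = false)
    (hp : ∀ a < m, Runs w p (s a) (s (a + 1)) T) :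
    Runs w (loop c p) (s 0) (s m) (m * (1 + T) + 1) := by
  induction m generalizing s with
  | zero => simpa using Runs.loop_false hm
  | succ m ih =>
    have hrest := ih (fun a => s (a + 1)) (fun a ha => hc _ (by lia)) hm
      (fun a ha => hp _ (by lia))
    exact (Runs.loop_true (hc 0 (by lia)) (hp 0 (by lia)) hrest).mono (by lia)

/-- The program that executes `p` until the counter `i` is empty, each time after decreasing it. -/
def countdown (i : ℕ) (p : CounterProg α) : CounterProg α :=
  .loop (.counter i) (.seq (.dec i) p)

/-- In the course of a countdown from `m`, the counter `i` takes the values `m, …, 0`; the other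
data before the `a`-th execution of `p` are those of `s a`. -/
theorem Runs.countdown (s : ℕ → CounterState)
    (hp : ∀ a < m, Runs w p ⟨(s a).flag, (s a).head, update (s a).count i (m - (a + 1))⟩
      ⟨(s (a + 1)).flag, (s (a + 1)).head, update (s (a + 1)).count i (m - (a + 1))⟩ T) :
    Runs w (countdown i p) ⟨(s 0).flag, (s 0).head, update (s 0).count i m⟩
      ⟨(s m).flag, (s m).head, update (s m).count i 0⟩ (m * (2 + T) + 1) := by
  have hloop := Runs.loop (w := w) (c := .counter i) (p := .seq (.dec i) p) (m := m) (T := 1 + T)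
    (fun a => ⟨(s a).flag, (s a).head, update (s a).count i (m - a)⟩)
    (by simp +contextual [CounterTest.eval]) (by simp [CounterTest.eval]) fun a ha => ?_
  · simpa [← add_assoc, CounterProg.countdown] using hloop
  · refine Runs.seq ?_ (hp a ha)
    simpa [Nat.sub_sub] using Runs.dec (w := w) i _ _ (update (s a).count i (m - a))

/-- The program that empties a counter. -/
def clear (i : ℕ) : CounterProg α :=
  .loop (.counter i) (.dec i)

theorem runs_clear (i : ℕ) (b : Bool) (h : ℕ) (x : ℕ → ℕ) :
    Runs w (clear i) ⟨b, h, x⟩ ⟨b, h, update x i 0⟩ (x i * 2 + 1) := by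
  have hloop := Runs.loop (w := w) (c := .counter i) (p := .dec i) (m := x i) (T := 1)
    (fun a => ⟨b, h, update x i (x i - a)⟩) (by simp +contextual [CounterTest.eval])
    (by simp [CounterTest.eval]) fun a _ => ?_
  · simpa [clear] using hloop
  · simpa [Nat.sub_sub] using Runs.dec (w := w) i b h (update x i (x i - a))

/-- The program that adds the counter `i` to the counter `j`, and empties `i`. -/
def move (i j : ℕ) : CounterProg α :=
  countdown i (.inc j)

theorem runs_move (hij : i ≠ j) (b : Bool) (h : ℕ) (x : ℕ → ℕ) :
    Runs w (move i j) ⟨b, h, x⟩ ⟨b, h, update (update x j (x j + x i)) i 0⟩ (x i * 3 + 1) := by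
  have hloop := Runs.countdown (w := w) (i := i) (p := .inc j) (m := x i) (T := 1)
    (fun a => ⟨b, h, update x j (x j + a)⟩) fun a _ =>
      (Runs.inc j b h _).congr (fun _ => rfl) (by grind) le_rfl
  exact hloop.congr (by grind) (by grind) (by lia)

/-- The program that moves the contents of the counter `i` to the counter `j`, replacing those of
`j`. -/
def moveTo (i j : ℕ) : CounterProg α :=
  .seq (clear j) (move i j)

theorem runs_moveTo (hij : i ≠ j) (b : Bool) (h : ℕ) (x : ℕ → ℕ) :
    Runs w (moveTo i j) ⟨b, h, x⟩ ⟨b, h, update (update x j (x i)) i 0⟩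
      (x j * 2 + x i * 3 + 2) :=
  ((runs_clear j b h x).seq (runs_move hij b h _)).congr (fun _ => rfl) (by grind) (by grind)

/-- The program that adds the counter `i` to the counter `j`; it needs an empty counter `t`. -/
def copy (i j t : ℕ) : CounterProg α :=
  .seq (countdown i (.seq (.inc j) (.inc t))) (move t i)

theorem runs_copy (hij : i ≠ j) (hit : i ≠ t) (hjt : j ≠ t) (b : Bool) (h : ℕ) (hx : x t = 0) :
    Runs w (copy i j t) ⟨b, h, x⟩ ⟨b, h, update x j (x j + x i)⟩ (x i * 7 + 2) := by
  have hloop := Runs.countdown (w := w) (i := i) (p := .seq (.inc j) (.inc t)) (m := x i) (T := 2)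
    (fun a => ⟨b, h, update (update x j (x j + a)) t a⟩) fun a _ =>
      ((Runs.inc j b h _).seq (.inc t b h _)).congr (fun _ => rfl) (by grind) le_rfl
  exact (hloop.seq (runs_move hit.symm b h _)).congr (by grind) (by grind) (by grind)

/-- The program that executes `p` as many times as the counter `i` says; it needs an empty counter
`u`, which counts the remaining executions of `p`, and an empty counter `t`. -/
def iter (i u t : ℕ) (p : CounterProg α) : CounterProg α :=
  .seq (copy i u t) (countdown u p)

theorem Runs.iter (s : ℕ → CounterState) (hiu : i ≠ u) (hit : i ≠ t) (hut : u ≠ t)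
    (hm : (s 0).count i = m) (ht : (s 0).count t = 0) (hu : (s 0).count u = 0)
    (hu' : (s m).count u = 0)
    (hp : ∀ a < m, ∀ v ≤ m, Runs w p ⟨(s a).flag, (s a).head, update (s a).count u v⟩
      ⟨(s (a + 1)).flag, (s (a + 1)).head, update (s (a + 1)).count u v⟩ T) :
    Runs w (iter i u t p) (s 0) (s m) (m * (9 + T) + 3) := by
  have hcopy := runs_copy (w := w) hiu hit hut (s 0).flag (s 0).head ht
  rw [hu, hm, zero_add] at hcopy
  exact (hcopy.seq (Runs.countdown s fun a ha => hp a ha _ (by lia))).congr (fun _ => rfl)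
    (by grind) (by lia)

/-- The program that moves the head to the right end of the input and counts the occurrences of the
symbol `a` on the way. -/
def countSymbol [BEq α] (i : ℕ) (a : α) : CounterProg α :=
  .loop (.symbol Option.isSome) <|
    .seq (.ite (.symbol (· == some a)) (.inc i) (.setFlag false)) .right

theorem runs_countSymbol [BEq α] [LawfulBEq α] (w : List α) (hx : x i = 0) (a : α) :
    Runs w (countSymbol i a) ⟨false, 0, x⟩ ⟨false, w.length, update x i (w.count a)⟩
      (w.length * 4 + 1) := by
  have hloop := Runs.loop (w := w) (c := .symbol Option.isSome) (m := w.length) (T := 3)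
    (p := .seq (.ite (.symbol (· == some a)) (.inc i) (.setFlag false)) .right)
    (fun h => ⟨false, h, update x i ((w.take h).count a)⟩)
    (by simp +contextual [CounterTest.eval]) (by simp [CounterTest.eval]) fun h hh => ?_
  · exact hloop.congr
      (fun _ => by rw [List.take_zero, List.count_nil, ← hx, update_eq_self]) (by simp) le_rfl
  have htake : (w.take (h + 1)).count a = (w.take h).count a + if w[h] == a then 1 else 0 := by
    rw [List.take_succ_eq_append_getElem hh, List.count_append]
    simp [List.count_singleton]
  refine Runs.seq (t := 2) ?_ (.right hh)
  by_cases ha : w[h] = a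
  · have hinc := Runs.inc (w := w) i false h (update x i ((w.take h).count a))
    exact .ite_true (by simp [CounterTest.eval, hh, ha])
      (hinc.congr (fun _ => rfl) (by simp [htake, ha]) le_rfl)
  · have hset := Runs.setFlag (w := w) false false h (update x i ((w.take h).count a))
    exact .ite_false (by simp [CounterTest.eval, hh, ha])
      (hset.congr (fun _ => rfl) (by simp [htake, ha]) le_rfl)

end Loops

section Moves

variable {α : Type} {w : List α} {h i m m' t u : ℕ} {x : ℕ → ℕ} {p q p' q' : CounterProg α}
  {T T' : ℕ}

/-- The programs `p` and `q` move the head by `m` cells to the right and back to the left. -/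
def Moves (w : List α) (p q : CounterProg α) (x : ℕ → ℕ) (m T : ℕ) : Prop :=
  ∀ b h, h + m ≤ w.length →
    Runs w p ⟨b, h, x⟩ ⟨b, h + m, x⟩ T ∧ Runs w q ⟨b, h + m, x⟩ ⟨b, h, x⟩ T

theorem moves_right_left (w : List α) (x : ℕ → ℕ) : Moves w right left x 1 1 :=
  fun _ _ hh => ⟨.right hh, .left hh⟩

theorem Moves.seq (hp : Moves w p q x m T) (hp' : Moves w p' q' x m' T') :
    Moves w (seq p p') (seq q' q) x (m + m') (T + T') := by
  intro b h hh
  have h₁ := hp b h (by lia)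
  have h₂ := hp' b (h + m) (by lia)
  rw [← add_assoc]
  exact ⟨h₁.1.seq h₂.1, (h₂.2.seq h₁.2).mono (by lia)⟩

theorem Moves.iter (hiu : i ≠ u) (hit : i ≠ t) (hut : u ≠ t) (hu : x u = 0) (ht : x t = 0)
    (hp : ∀ v ≤ x i, Moves w p q (update x u v) m T) :
    Moves w (iter i u t p) (iter i u t q) x (x i * m) (x i * (9 + T) + 3) := by
  intro b h hh
  have hle (a : ℕ) (ha : a < x i) : h + a * m + m ≤ w.length := by
    have := Nat.mul_le_mul_right m (Nat.succ_le_of_lt ha)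
    lia
  constructor
  · have := Runs.iter (fun a => ⟨b, h + a * m, x⟩) hiu hit hut rfl ht hu hu fun a ha v hv => by
      simpa only [Nat.succ_mul, add_assoc] using (hp v hv b _ (hle a ha)).1
    simpa using this
  · have := Runs.iter (fun a => ⟨b, h + (x i - a) * m, x⟩) hiu hit hut rfl ht hu hu
      fun a ha v hv => by
        have hr := (hp v hv b _ (hle (x i - (a + 1)) (by lia))).2
        rwa [add_assoc, ← Nat.succ_mul, Nat.succ_eq_add_one,
          show x i - (a + 1) + 1 = x i - a by lia] at hr
    simpa using this

theorem moves_row {u t : ℕ} (hu : u ≠ 0) (ht : t ≠ 0) (hut : u ≠ t) (hxu : x u = 0)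
    (hxt : x t = 0) : Moves w (.seq (iter 0 u t .right) .right) (.seq .left (iter 0 u t .left)) x
      (x 0 + 1) (x 0 * 10 + 4) := by
  have hcells := Moves.iter (w := w) hu.symm ht.symm hut hxu hxt fun _ _ => moves_right_left w _
  simpa using hcells.seq (moves_right_left w x)

theorem exists_moves_entry (α : Type) (i j k : ℕ) : ∃ p q : CounterProg α,
    ∀ (w : List α) (x : ℕ → ℕ), i ≤ k → j ≤ k → (∀ a, k < a → x a = 0) →
      Moves w p q x (x i * (x 0 + 1) + x j) (x i * (x 0 * 10 + 13) + x j * 10 + 6) := by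
  refine ⟨.seq (iter i (k + 1) (k + 3) (.seq (iter 0 (k + 2) (k + 3) .right) .right))
      (iter j (k + 1) (k + 3) .right),
    .seq (iter j (k + 1) (k + 3) .left)
      (iter i (k + 1) (k + 3) (.seq .left (iter 0 (k + 2) (k + 3) .left))),
    fun w x hi hj hx => ?_⟩
  have hrow : ∀ v ≤ x i, Moves w (.seq (iter 0 (k + 2) (k + 3) .right) .right)
      (.seq .left (iter 0 (k + 2) (k + 3) .left)) (update x (k + 1) v) (x 0 + 1)
        (x 0 * 10 + 4) := fun v _ => by
    simpa using moves_row (x := update x (k + 1) v) (w := w) (u := k + 2) (t := k + 3)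
      (by lia) (by lia) (by lia) (by grind) (by grind)
  have hrows := Moves.iter (u := k + 1) (t := k + 3) (by lia) (by lia) (by lia) (hx _ (by lia))
    (hx _ (by lia)) hrow
  have hcells := Moves.iter (x := x) (i := j) (u := k + 1) (t := k + 3) (by lia) (by lia) (by lia)
    (hx _ (by lia)) (hx _ (by lia)) fun _ _ => moves_right_left w _
  intro b h hh
  have := (hrows.seq hcells) b h (by simpa using hh)
  simp only [mul_one] at this
  exact ⟨this.1.mono (by lia), this.2.mono (by lia)⟩

end Moves

open Classical in
/-- On the input `w`, with the head at the left end and the counters `x`, the program `p` sets the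
flag to the truth value of `Q` in at most `T` steps, and leaves the head and the counters as they
were. -/
def Tests {α : Type} (w : List α) (p : CounterProg α) (x : ℕ → ℕ) (Q : Prop) (T : ℕ) : Prop :=
  ∀ b, Runs w p ⟨b, 0, x⟩ ⟨decide Q, 0, x⟩ T

section Tests

variable {α : Type} {w : List α} {p q : CounterProg α} {x : ℕ → ℕ} {P Q : Prop} {T T' : ℕ}

theorem Tests.runs [Decidable Q] (hp : Tests w p x Q T) (b : Bool) :
    Runs w p ⟨b, 0, x⟩ ⟨decide Q, 0, x⟩ T := by
  convert hp b

theorem Tests.runs_true (hp : Tests w p x Q T) (hQ : Q) (b : Bool) :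
    Runs w p ⟨b, 0, x⟩ ⟨true, 0, x⟩ T := by
  simpa [hQ] using hp b

theorem Tests.runs_false (hp : Tests w p x Q T) (hQ : ¬Q) (b : Bool) :
    Runs w p ⟨b, 0, x⟩ ⟨false, 0, x⟩ T := by
  simpa [hQ] using hp b

theorem Tests.congr (hp : Tests w p x Q T) (hPQ : P ↔ Q) : Tests w p x P T :=
  propext hPQ ▸ hp

theorem tests_ite (c : CounterTest α) (hc : ∀ b, c.eval w ⟨b, 0, x⟩ = true ↔ Q) :
    Tests w (ite c (setFlag true) (setFlag false)) x Q 2 := by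
  intro b
  by_cases hQ : Q
  · simpa [hQ] using Runs.ite_true ((hc b).2 hQ) (.setFlag true b 0 x)
  · simpa [hQ] using Runs.ite_false (by simpa [hQ] using hc b) (.setFlag false b 0 x)

theorem Tests.not (hp : Tests w p x Q T) :
    Tests w (seq p (ite .flag (setFlag false) (setFlag true))) x (¬Q) (T + 2) := by
  intro b
  by_cases hQ : Q
  · simpa [hQ] using (hp.runs_true hQ b).seq (.ite_true rfl (.setFlag _ _ _ _))
  · simpa [hQ] using (hp.runs_false hQ b).seq (.ite_false rfl (.setFlag _ _ _ _))

theorem Tests.and (hp : Tests w p x P T) (hq : Tests w q x Q T') :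
    Tests w (seq p (ite .flag q (setFlag false))) x (P ∧ Q) (T + T' + 2) := by
  by_cases hP : P
  · refine Tests.congr (fun b => ?_) (and_iff_right hP)
    exact ((hp.runs_true hP b).seq (.ite_true rfl (hq true))).mono (by lia)
  · refine Tests.congr (Q := False) (fun b => ?_) (by tauto)
    simpa using ((hp.runs_false hP b).seq (.ite_false rfl (.setFlag false false 0 x))).mono
      (Nat.add_le_add (T.le_add_right T') le_rfl)

/-- The program that increases the counter `v` until `p` clears the flag. -/
def find (v : ℕ) (p : CounterProg α) : CounterProg α :=
  .seq p (.loop .flag (.seq (.inc v) p))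

theorem runs_find {P : ℕ → Prop} {m v : ℕ} (hm : P m) (hlt : ∀ a < m, ¬P a)
    (hp : ∀ a ≤ m, Tests w p (update x v a) (¬P a) T) (b : Bool) :
    Runs w (find v p) ⟨b, 0, update x v 0⟩ ⟨false, 0, update x v m⟩ (T + (m * (2 + T) + 1)) := by
  have htest (a : ℕ) (ha : a ≤ m) : Tests w p (update x v a) (a < m) T :=
    (hp a ha).congr ⟨hlt a, fun h => ha.lt_of_ne fun h' => h (h' ▸ hm)⟩
  have hloop := Runs.loop (w := w) (c := .flag) (p := .seq (.inc v) p) (m := m) (T := 1 + T)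
    (fun a => ⟨decide (a < m), 0, update x v a⟩) (fun a ha => decide_eq_true ha)
    (decide_eq_false m.lt_irrefl) fun a ha => by
      refine .seq ?_ ((htest (a + 1) ha).runs (decide (a < m)))
      simpa using Runs.inc v (decide (a < m)) 0 (update x v a)
  simpa [find, ← add_assoc] using ((htest 0 m.zero_le).runs b).seq hloop

end Tests

section Search

variable {α : Type} {w : List α} {p : CounterProg α} {x : ℕ → ℕ} {P : ℕ → Prop} {T : ℕ}
  {i v u f t : ℕ}

/-- The body of the loop in `anyBelow`. -/
def anyStep (v f : ℕ) (p : CounterProg α) : CounterProg α :=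
  .seq p <| .seq (.ite .flag (.inc f) (.setFlag false)) <| .seq (.setFlag false) (.inc v)

/-- The program that looks for a value of the counter `v`, less than the counter `i`, that passes
the test `p`. It needs the empty counters `v`, `u`, `t`, and `f`, which counts the values found. -/
def anyBelow (i v u f t : ℕ) (p : CounterProg α) : CounterProg α :=
  .seq (.setFlag false) <| .seq (iter i u t (anyStep v f p)) <|
    .seq (.ite (.counter f) (.setFlag true) (.setFlag false)) <| .seq (clear v) (clear f)

theorem runs_anyStep [DecidablePred P] {a : ℕ} (hvf : v ≠ f)
    (hp : Tests w p (update (update x v a) f (Nat.count P a)) (P a) T) :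
    Runs w (anyStep v f p) ⟨false, 0, update (update x v a) f (Nat.count P a)⟩
      ⟨false, 0, update (update x v (a + 1)) f (Nat.count P (a + 1))⟩ (T + 4) := by
  have hcount : Runs w (.ite .flag (.inc f) (.setFlag false))
      ⟨decide (P a), 0, update (update x v a) f (Nat.count P a)⟩
      ⟨decide (P a), 0, update (update x v a) f (Nat.count P (a + 1))⟩ 2 := by
    by_cases h : P a
    · simpa [h, Nat.count_succ] using Runs.ite_true (q := .setFlag false)
        (by simp [CounterTest.eval, h])
        (.inc f (decide (P a)) 0 (update (update x v a) f (Nat.count P a)))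
    · simpa [h, Nat.count_succ] using Runs.ite_false (c := .flag) (p := .inc f)
        (by simp [CounterTest.eval, h])
        (.setFlag false (decide (P a)) 0 (update (update x v a) f (Nat.count P a)))
  refine ((hp.runs false).seq (hcount.seq ((Runs.setFlag _ _ _ _).seq (.inc v _ _ _)))).congr
    (fun _ => rfl) (by grind) (by lia)

theorem tests_anyBelow (hd : [i, v, u, f, t].Nodup) (hv : x v = 0) (hu : x u = 0) (hf : x f = 0)
    (ht : x t = 0)
    (hp : ∀ a < x i, ∀ c d, Tests w p (update (update (update x v a) f c) u d) (P a) T) :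
    Tests w (anyBelow i v u f t p) x (∃ a < x i, P a) (x i * (T + 17) + 9) := by
  classical
  intro b
  simp only [List.nodup_cons, List.mem_cons, not_or, List.not_mem_nil] at hd
  have hiter := Runs.iter (w := w) (i := i) (u := u) (t := t) (m := x i) (p := anyStep v f p)
    (fun a => ⟨false, 0, update (update x v a) f (Nat.count P a)⟩) (by lia) (by lia) (by lia)
    (by grind) (by grind) (by grind) (by grind) fun a ha d _ => by
      have hstep := runs_anyStep (w := w) (P := P) (p := p) (x := update x u d) (v := v) (f := f)
        (a := a) (T := T) (by lia) (by
          convert hp a ha (Nat.count P a) d using 1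
          grind)
      exact hstep.congr (by grind) (by grind) le_rfl
  have hex : 0 < Nat.count P (x i) ↔ ∃ a < x i, P a := by
    simp [Nat.pos_iff_ne_zero, Nat.count_iff_forall_not]
  have htest := tests_ite (w := w) (x := update (update x v (x i)) f (Nat.count P (x i)))
    (Q := ∃ a < x i, P a) (.counter f) (by simpa [CounterTest.eval] using hex)
  refine ((Runs.setFlag _ _ _ _).seq (hiter.seq ((htest _).seq
    ((runs_clear v _ 0 _).seq (runs_clear f _ 0 _))))).congr (by grind) (by grind) ?_
  have := Nat.count_le (p := P) (n := x i)
  grind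

end Search

end CounterProg

theorem getElem?_flatMap_of_length {α β : Type*} {f : α → List β} {m : ℕ} {l : List α}
    (hf : ∀ a ∈ l, (f a).length = m) {i j : ℕ} (hi : i < l.length) (hj : j < m) :
    (l.flatMap f)[i * m + j]? = (f l[i])[j]? := by
  induction l generalizing i with
  | nil => simp at hi
  | cons a l ih =>
    have ha := hf a (by simp)
    cases i with
    | zero => simp [List.getElem?_append, ha, hj]
    | succ i =>
      rw [List.flatMap_cons, List.getElem?_append_right (by lia), ha,
        show (i + 1) * m + j - m = i * m + j by lia]
      exact ih (fun b hb => hf b (by simp [hb])) (by simpa using hi)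

open Classical in
theorem getElem?_encodeGraph {n : ℕ} (G : SimpleGraph (Fin n)) (i j : Fin n) :
    (encodeGraph ⟨n, G⟩)[i * (n + 1) + j]? = some (some (decide (G.Adj i j))) := by
  rw [encodeGraph, getElem?_flatMap_of_length (by simp) (by simp) (by lia)]
  simp

theorem length_encodeGraph (G : LabelledGraph) : (encodeGraph G).length = G.1 * (G.1 + 1) := by
  simp [encodeGraph, List.length_flatMap]

theorem count_none_encodeGraph (G : LabelledGraph) : (encodeGraph G).count none = G.1 := by
  simp [encodeGraph, List.count_flatMap, comp_def, List.count_eq_zero_of_not_mem]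

theorem exists_iterate_lt_card {α : Type*} [Fintype α] {f : α → α} {P : α → Prop} {c : α}
    (h : ∃ m, P (f^[m] c)) : ∃ m < Fintype.card α, P (f^[m] c) := by
  classical
  refine ⟨Nat.find h, ?_, Nat.find_spec h⟩
  have hinj : Injective fun a : Fin (Nat.find h + 1) => f^[a] c := by
    intro a b hab
    by_contra! hne
    wlog hlt : a < b generalizing a b
    · exact this hab.symm hne.symm (lt_of_le_of_ne (not_lt.1 hlt) hne.symm)
    have hP := Nat.find_spec h
    rw [← Nat.sub_add_cancel (Nat.lt_succ_iff.1 b.isLt), iterate_add_apply] at hP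
    rw [← show f^[a] c = f^[b] c from hab, ← iterate_add_apply] at hP
    exact Nat.find_min h (by lia) hP
  simpa using Fintype.card_le_of_injective _ hinj

open Classical in
/-- One step along the relation `R`, unless `c` satisfies `P` or has no successor. -/
noncomputable def seek {α : Type*} (R : α → α → Prop) (P : α → Prop) (c : α) : α :=
  if h : ¬P c ∧ ∃ e, R c e then h.2.choose else c

section Seek

variable {α : Type*} {R : α → α → Prop} {P : α → Prop} {c e : α}

theorem seek_eq_of_rel (hR : Relator.RightUnique R) (hc : ¬P c) (h : R c e) : seek R P c = e := by
  have hs : ¬P c ∧ ∃ e, R c e := ⟨hc, e, h⟩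
  rw [seek, dif_pos hs]
  exact hR hs.2.choose_spec h

theorem seek_eq_self (h : ¬(¬P c ∧ ∃ e, R c e)) : seek R P c = c :=
  dif_neg h

theorem reflTransGen_iterate_seek (R : α → α → Prop) (P : α → Prop) (c : α) (m : ℕ) :
    Relation.ReflTransGen R c ((seek R P)^[m] c) := by
  induction m with
  | zero => rfl
  | succ m ih =>
    rw [iterate_succ_apply']
    by_cases h : ¬P ((seek R P)^[m] c) ∧ ∃ e, R ((seek R P)^[m] c) e
    · exact ih.tail (by rw [seek, dif_pos h]; exact h.2.choose_spec)
    · rwa [seek_eq_self h]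

theorem exists_reflTransGen_iff_iterate_seek [Fintype α] (hR : Relator.RightUnique R) :
    (∃ e, Relation.ReflTransGen R c e ∧ P e) ↔ P ((seek R P)^[Fintype.card α] c) := by
  refine ⟨?_, fun h => ⟨_, reflTransGen_iterate_seek R P c _, h⟩⟩
  rintro ⟨e, he, hPe⟩
  have hex : ∃ m, P ((seek R P)^[m] c) := by
    induction he using Relation.ReflTransGen.head_induction_on with
    | refl => exact ⟨0, hPe⟩
    | @head a b hab _ ih =>
      obtain ⟨m, hm⟩ := ih
      by_cases ha : P a
      · exact ⟨0, ha⟩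
      · exact ⟨m + 1, by rwa [iterate_succ_apply, seek_eq_of_rel hR ha hab]⟩
  obtain ⟨m, hm, hPm⟩ := exists_iterate_lt_card hex
  rw [← Nat.sub_add_cancel hm.le, iterate_add_apply]
  have hfix : IsFixedPt (seek R P) ((seek R P)^[m] c) := seek_eq_self (by tauto)
  rwa [hfix.iterate]

end Seek

section PolyDecidable

open CounterProg

/-- The counters `x` represent a valuation `y` of variables by vertices of a graph with `n`
vertices: counter `0` holds `n`, and the value of the variable `i` is in counter `r i`. The counters
above `k` are empty. -/
structure Stores {ι : Type} (n : ℕ) (r : ι → ℕ) (k : ℕ) (y : ι → Fin n) (x : ℕ → ℕ) : Prop where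
  zero : x 0 = n
  le (i : ι) : r i ≤ k
  eq (i : ι) : x (r i) = y i
  free (j : ℕ) : k < j → x j = 0

section Stores

variable {ι : Type} {n k k' m v : ℕ} {r : ι → ℕ} {y : ι → Fin n} {x : ℕ → ℕ}

theorem Stores.update (h : Stores n r k y x) (hm : k < m) (hm' : m ≤ k') (v : ℕ) :
    Stores n r k' y (update x m v) where
  zero := by rw [update_of_ne (by lia), h.zero]
  le i := (h.le i).trans (by lia)
  eq i := by rw [update_of_ne ((h.le i).trans_lt hm).ne, h.eq]
  free j hj := by rw [update_of_ne (by lia), h.free j (by lia)]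

theorem Stores.push (h : Stores n r k y x) (a : Fin n) :
    Stores n (fun i => i.elim (k + 1) r) (k + 1) (fun i : Option ι => i.elim a y)
      (Function.update x (k + 1) a) where
  zero := (h.update k.lt_succ_self le_rfl a).zero
  le
    | none => le_rfl
    | some i => (h.le i).trans k.le_succ
  eq
    | none => update_self ..
    | some i => (h.update k.lt_succ_self le_rfl a).eq i
  free := (h.update k.lt_succ_self le_rfl a).free

theorem Stores.comp {κ : Type} (h : Stores n r k y x) (s : κ → ι) :
    Stores n (r ∘ s) k (y ∘ s) x where
  zero := h.zero
  le i := h.le (s i)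
  eq i := h.eq (s i)
  free := h.free

theorem Stores.runs_copy {w : List (Option Bool)} (hx : Stores n r k y x) (i : ι) (b : Bool)
    (h : ℕ) : Runs w (copy (r i) (k + 1) (k + 2)) ⟨b, h, x⟩ ⟨b, h, Function.update x (k + 1) (y i)⟩
      (n * 7 + 2) := by
  have hi := hx.le i
  have hrun := CounterProg.runs_copy (w := w) (i := r i) (j := k + 1) (t := k + 2) (by lia)
    (by lia) (by lia) b h (hx.free (k + 2) (by lia))
  rw [hx.free (k + 1) (by lia), hx.eq i, zero_add] at hrun
  exact hrun.mono (by lia)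

/-- The counters `x`, with the pair `c` of vertices in the first two counters above `k`. -/
def dartState (k : ℕ) (x : ℕ → ℕ) (c : Fin n × Fin n) : ℕ → ℕ :=
  update (update x (k + 1) c.1) (k + 2) c.2

theorem update_dartState (k u v : ℕ) (x : ℕ → ℕ) (c e : Fin n × Fin n) :
    update (update (update (update (dartState k x c) (k + 3) u) (k + 4) v) (k + 1) e.1) (k + 2)
      e.2 = update (update (dartState k x e) (k + 3) u) (k + 4) v := by
  funext i
  simp only [dartState, update_apply]
  grind

end Stores

/-- The relation `Q` on the vertices of labelled graphs is decided by a counter program in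
polynomial time. The program has to work for every choice `r` of counters for the variables, with
every bound `k` on the counters in use. -/
def PolyDecidable {ι : Type} (Q : ∀ n, SimpleGraph (Fin n) → (ι → Fin n) → Prop) : Prop :=
  ∀ (r : ι → ℕ) (k : ℕ), ∃ (p : CounterProg (Option Bool)) (B : Polynomial ℕ),
    ∀ (n : ℕ) (G : SimpleGraph (Fin n)) (y : ι → Fin n) (x : ℕ → ℕ), Stores n r k y x →
      Tests (encodeGraph ⟨n, G⟩) p x (Q n G y) (B.eval n)

namespace PolyDecidable

variable {ι : Type} {P Q : ∀ n, SimpleGraph (Fin n) → (ι → Fin n) → Prop}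

theorem congr (hQ : PolyDecidable Q) (h : ∀ n G y, P n G y ↔ Q n G y) : PolyDecidable P := by
  obtain rfl : P = Q := funext fun n => funext fun G => funext fun y => propext (h n G y)
  exact hQ

protected theorem not (hQ : PolyDecidable Q) : PolyDecidable fun n G y => ¬Q n G y := by
  intro r k
  obtain ⟨p, B, hp⟩ := hQ r k
  exact ⟨_, B + 2, fun n G y x hx => by simpa using (hp n G y x hx).not⟩

protected theorem and (hP : PolyDecidable P) (hQ : PolyDecidable Q) :
    PolyDecidable fun n G y => P n G y ∧ Q n G y := by
  intro r k
  obtain ⟨p, B, hp⟩ := hP r k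
  obtain ⟨q, C, hq⟩ := hQ r k
  exact ⟨_, B + C + 2, fun n G y x hx => by simpa using (hp n G y x hx).and (hq n G y x hx)⟩

protected theorem or (hP : PolyDecidable P) (hQ : PolyDecidable Q) :
    PolyDecidable fun n G y => P n G y ∨ Q n G y :=
  (hP.not.and hQ.not).not.congr fun _ _ _ => by tauto

theorem lt (i j : ι) : PolyDecidable fun _ _ y => y i < y j := by
  intro r k
  refine ⟨.seq (copy (r j) (k + 1) (k + 2)) <| .seq (iter (r i) (k + 2) (k + 3) (.dec (k + 1))) <|
    .seq (.ite (.counter (k + 1)) (.setFlag true) (.setFlag false)) (clear (k + 1)),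
    20 * Polynomial.X + 10, fun n G y x hx b => ?_⟩
  have hi := hx.le i
  have hcopy := hx.runs_copy (w := encodeGraph ⟨n, G⟩) j b 0
  have hiter := Runs.iter (w := encodeGraph ⟨n, G⟩) (i := r i) (u := k + 2) (t := k + 3)
    (m := y i) (p := .dec (k + 1)) (T := 1)
    (fun a => ⟨b, 0, Function.update x (k + 1) (y j - a)⟩) (by lia) (by lia) (by lia)
    (by grind [hx.eq i]) (by grind [hx.free (k + 3)]) (by grind [hx.free (k + 2)])
    (by grind [hx.free (k + 2)]) fun a _ v _ =>
      (Runs.dec (k + 1) b 0 _).congr (fun _ => rfl) (by grind) le_rfl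
  have htest := tests_ite (w := encodeGraph ⟨n, G⟩)
    (x := Function.update x (k + 1) (y j - y i)) (Q := y i < y j) (.counter (k + 1))
    (by simp [CounterTest.eval])
  refine (hcopy.seq (hiter.seq ((htest b).seq (runs_clear (k + 1) _ 0 _)))).congr (fun _ => rfl)
    (by grind [hx.free (k + 1)]) ?_
  simp only [Function.update_self, Polynomial.eval_add, Polynomial.eval_mul,
    Polynomial.eval_ofNat, Polynomial.eval_X]
  lia

protected theorem eq (i j : ι) : PolyDecidable fun _ _ y => y i = y j :=
  ((lt i j).or (lt j i)).not.congr fun _ _ _ => by lia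

theorem adj (i j : ι) : PolyDecidable fun _ G y => G.Adj (y i) (y j) := by
  classical
  intro r k
  obtain ⟨p, q, hpq⟩ := exists_moves_entry (Option Bool) (r i) (r j) k
  let test : CounterTest (Option Bool) := .symbol (· == some (some true))
  refine ⟨.seq p <| .seq (.ite test (.setFlag true) (.setFlag false)) q,
    2 * (.X * (.X * 10 + 13) + .X * 10 + 6) + 2, fun n G y x hx b => ?_⟩
  have hmoves := hpq (encodeGraph ⟨n, G⟩) x (hx.le i) (hx.le j) hx.free
  rw [hx.eq i, hx.eq j, hx.zero] at hmoves
  have hentry := getElem?_encodeGraph G (y i) (y j)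
  have hlt : (y i : ℕ) * (n + 1) + y j < (encodeGraph ⟨n, G⟩).length :=
    (List.getElem?_eq_some_iff.1 hentry).1
  have htest : ∀ c, Runs (encodeGraph ⟨n, G⟩) (.ite test (.setFlag true) (.setFlag false))
      ⟨c, 0 + (y i * (n + 1) + y j), x⟩
      ⟨decide (G.Adj (y i) (y j)), 0 + (y i * (n + 1) + y j), x⟩ 2 := by
    intro c
    by_cases h : G.Adj (y i) (y j)
    · simpa [h] using Runs.ite_true (by simp [test, CounterTest.eval, hentry, h])
        (.setFlag true c _ x)
    · simpa [h] using Runs.ite_false (by simp [test, CounterTest.eval, hentry, h])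
        (.setFlag false c _ x)
  refine ((hmoves b 0 (by lia)).1.seq ((htest b).seq (hmoves _ 0 (by lia)).2)).mono ?_
  have hle : (y i : ℕ) * (n * 10 + 13) + y j * 10 + 6 ≤ n * (n * 10 + 13) + n * 10 + 6 := by
    gcongr <;> exact (Fin.isLt _).le
  simp only [Polynomial.eval_add, Polynomial.eval_mul, Polynomial.eval_ofNat, Polynomial.eval_X]
  lia

theorem exists_vertex {Q : ∀ n, SimpleGraph (Fin n) → (ι → Fin n) → Fin n → Prop}
    (hQ : PolyDecidable fun n G (y : Option ι → Fin n) => Q n G (fun i => y (some i)) (y none)) :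
    PolyDecidable fun n G y => ∃ a, Q n G y a := by
  intro r k
  obtain ⟨p, B, hp⟩ := hQ (fun i => i.elim (k + 1) r) (k + 3)
  refine ⟨anyBelow 0 (k + 1) (k + 3) (k + 2) (k + 4) p, .X * (B + 17) + 9, fun n G y x hx => ?_⟩
  have hex := tests_anyBelow (w := encodeGraph ⟨n, G⟩) (p := p) (x := x) (i := 0) (v := k + 1)
    (u := k + 3) (f := k + 2) (t := k + 4) (P := fun a => ∃ h : a < n, Q n G y ⟨a, h⟩)
    (T := B.eval n) (by simp) (hx.free _ (by lia)) (hx.free _ (by lia)) (hx.free _ (by lia))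
    (hx.free _ (by lia)) fun a ha c d => by
      have han : a < n := hx.zero ▸ ha
      have hstores := ((hx.push ⟨a, han⟩).update (k + 1).lt_succ_self le_rfl c).update
        (k + 2).lt_succ_self le_rfl d
      exact (hp n G _ _ hstores).congr ⟨fun ⟨_, h⟩ => h, fun h => ⟨han, h⟩⟩
  rw [hx.zero] at hex
  simpa using hex.congr (P := ∃ a, Q n G y a)
    ⟨fun ⟨a, h⟩ => ⟨a, a.isLt, a.isLt, h⟩, fun ⟨a, _, h, hQ⟩ => ⟨⟨a, h⟩, hQ⟩⟩

theorem exists_pair {Q : ∀ n, SimpleGraph (Fin n) → (ι → Fin n) → Fin n × Fin n → Prop}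
    (hQ : PolyDecidable fun n G (y : Option (Option ι) → Fin n) =>
      Q n G (fun i => y (some (some i))) (y (some none), y none)) :
    PolyDecidable fun n G y => ∃ e, Q n G y e :=
  (exists_vertex (Q := fun n G y a => ∃ b, Q n G y (a, b)) (exists_vertex
    (Q := fun n G y b => Q n G (fun i => y (some i)) (y none, b)) hQ)).congr
    fun _ _ _ => Prod.exists

theorem comp {κ : Type} (hQ : PolyDecidable Q) (s : ι → κ) :
    PolyDecidable fun n G y => Q n G (y ∘ s) := by
  intro r k
  obtain ⟨p, B, hp⟩ := hQ (r ∘ s) k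
  exact ⟨p, B, fun n G y x hx => hp n G _ x (hx.comp s)⟩

theorem exists_runs_find {Q : ∀ n, SimpleGraph (Fin n) → (ι → Fin n) → Fin n → Prop}
    (hQ : PolyDecidable fun n G (y : Option ι → Fin n) => Q n G (fun i => y (some i)) (y none))
    (r : ι → ℕ) (k : ℕ) : ∃ (p : CounterProg (Option Bool)) (B : Polynomial ℕ),
      ∀ n G y x a b, Stores n r k y x → Q n G y a → (∀ a', Q n G y a' → a' = a) →
        Runs (encodeGraph ⟨n, G⟩) p ⟨b, 0, x⟩ ⟨false, 0, update x (k + 1) a⟩ (B.eval n) := by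
  obtain ⟨p, B, hp⟩ := hQ.not (fun i => i.elim (k + 1) r) (k + 1)
  refine ⟨find (k + 1) p, B + (.X * (2 + B) + 1), fun n G y x a b hx ha hu => ?_⟩
  have hfind := runs_find (w := encodeGraph ⟨n, G⟩) (p := p) (v := k + 1) (x := x) (m := a)
    (P := fun a => ∃ h : a < n, Q n G y ⟨a, h⟩) (T := B.eval n) ⟨a.isLt, ha⟩
    (fun c hc ⟨h, hQ⟩ => hc.ne (congrArg Fin.val (hu _ hQ)))
    (fun c hc => by
      have hcn : c < n := hc.trans_lt a.isLt
      exact (hp n G _ _ (hx.push ⟨c, hcn⟩)).congr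
        (not_congr ⟨fun ⟨_, h⟩ => h, fun h => ⟨hcn, h⟩⟩)) b
  refine hfind.congr (by grind [hx.free (k + 1)]) (fun _ => rfl) ?_
  simp

theorem exists_runs_find_pair
    {Q : ∀ n, SimpleGraph (Fin n) → (ι → Fin n) → Fin n × Fin n → Prop}
    (hQ : PolyDecidable fun n G (y : Option (Option ι) → Fin n) =>
      Q n G (fun i => y (some (some i))) (y (some none), y none))
    (r : ι → ℕ) (k : ℕ) : ∃ (p : CounterProg (Option Bool)) (B : Polynomial ℕ),
      ∀ n G y x e b, Stores n r k y x → Q n G y e → (∀ e', Q n G y e' → e' = e) →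
        Runs (encodeGraph ⟨n, G⟩) p ⟨b, 0, x⟩
          ⟨false, 0, update (update x (k + 1) e.1) (k + 2) e.2⟩ (B.eval n) := by
  obtain ⟨p, B, hp⟩ := exists_runs_find (Q := fun n G y a => ∃ b, Q n G y (a, b))
    (exists_vertex (Q := fun n G y b => Q n G (fun i => y (some i)) (y none, b)) hQ) r k
  obtain ⟨q, C, hq⟩ := exists_runs_find
    (Q := fun n G y b => Q n G (fun i => y (some i)) (y none, b)) hQ (fun i => i.elim (k + 1) r)
    (k + 1)
  refine ⟨.seq p q, B + C, fun n G y x e b hx he hu => ?_⟩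
  have hfst := hp n G y x e.1 b hx ⟨e.2, he⟩ fun a ⟨b, hb⟩ => congrArg Prod.fst (hu _ hb)
  have hsnd := hq n G _ _ e.2 false (hx.push e.1) he fun b hb => congrArg Prod.snd (hu _ hb)
  simpa using hfst.seq hsnd

theorem runs_moveTo_moveTo {w : List (Option Bool)} {z : ℕ → ℕ} {m : ℕ} (k l : ℕ) (hkl : k + 2 ≤ l)
    (hz : z l = 0) (hz' : z (l + 1) = 0) (hk : z k ≤ m) (hk' : z (k + 1) ≤ m) (e : Fin m × Fin m) :
    Runs w (.seq (moveTo l k) (moveTo (l + 1) (k + 1)))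
      ⟨false, 0, update (update z l e.1) (l + 1) e.2⟩
      ⟨false, 0, update (update z k e.1) (k + 1) e.2⟩ (m * 10 + 4) := by
  refine ((runs_moveTo (by lia) _ _ _).seq (runs_moveTo (by lia) _ _ _)).congr (fun _ => rfl)
    (by grind) ?_
  grind

section ReflTransGen

variable {R : ∀ n, SimpleGraph (Fin n) → Fin n × Fin n → Fin n × Fin n → Prop}
  {P : ∀ n, SimpleGraph (Fin n) → (ι → Fin n) → Fin n × Fin n → Prop}

theorem exists_runs_seek (hu : ∀ n G, Relator.RightUnique (R n G))
    (hR : PolyDecidable fun n G (y : Fin 4 → Fin n) => R n G (y 0, y 1) (y 2, y 3))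
    (hP : PolyDecidable fun n G (y : Option (Option ι) → Fin n) =>
      P n G (fun i => y (some (some i))) (y (some none), y none))
    (r : ι → ℕ) (k : ℕ) : ∃ (p : CounterProg (Option Bool)) (B : Polynomial ℕ),
      ∀ n G y x c u v, Stores n r k y x →
        Runs (encodeGraph ⟨n, G⟩) p
          ⟨false, 0, update (update (dartState k x c) (k + 3) u) (k + 4) v⟩
          ⟨false, 0,
            update (update (dartState k x (seek (R n G) (P n G y) c)) (k + 3) u) (k + 4) v⟩
          (B.eval n) := by
  have hRel : PolyDecidable fun n G (y : Option (Option (Option (Option ι))) → Fin n) =>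
      R n G (y (some (some (some none))), y (some (some none))) (y (some none), y none) :=
    hR.comp ![some (some (some none)), some (some none), some none, none]
  let r' : Option (Option ι) → ℕ := fun i => i.elim (k + 2) fun i => i.elim (k + 1) r
  have hex := exists_pair
    (Q := fun n G (y : Option (Option ι) → Fin n) => R n G (y (some none), y none)) hRel
  obtain ⟨p, B, hp⟩ := hP.not.and hex r' (k + 4)
  obtain ⟨q, C, hq⟩ := exists_runs_find_pair
    (Q := fun n G (y : Option (Option ι) → Fin n) => R n G (y (some none), y none)) hRel r' (k + 4)
  refine ⟨.seq p <| .ite .flag (.seq q <| .seq (moveTo (k + 5) (k + 1)) (moveTo (k + 6) (k + 2)))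
    (.setFlag false), B + C + 10 * .X + 6, fun n G y x c u v hx => ?_⟩
  have hstores := (((hx.push c.1).push c.2).update (k + 2).lt_succ_self le_rfl u).update
    (k + 3).lt_succ_self le_rfl v
  have htest := hp n G _ _ hstores
  by_cases hc : ¬P n G y c ∧ ∃ e, R n G c e
  · obtain ⟨hPc, e, he⟩ := hc
    have htrue := htest.runs_true ⟨hPc, e, he⟩ false
    have hfind := hq n G _ _ e true hstores he fun e' he' => hu n G he' he
    rw [seek_eq_of_rel (hu n G) hPc he]
    have hmove := runs_moveTo_moveTo (w := encodeGraph ⟨n, G⟩) (m := n) (k + 1) (k + 5) (by lia)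
      (z := update (update (dartState k x c) (k + 3) u) (k + 4) v)
      (by simp [dartState, hx.free (k + 5) (by lia)])
      (by simp [dartState, hx.free (k + 6) (by lia)]) (by simp [dartState]) (by simp [dartState]) e
    exact (htrue.seq (.ite_true rfl (hfind.seq hmove))).congr (fun _ => rfl)
      (congrFun (update_dartState k u v x c e))
      (by simp only [Polynomial.eval_add, Polynomial.eval_mul, Polynomial.eval_ofNat,
        Polynomial.eval_X]; lia)
  · rw [seek_eq_self hc]
    have hfalse := htest.runs_false (fun h => hc h) false
    exact (hfalse.seq (.ite_false rfl (.setFlag _ _ _ _))).congr (fun _ => rfl) (fun _ => rfl)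
      (by simp only [Polynomial.eval_add, Polynomial.eval_mul, Polynomial.eval_ofNat,
        Polynomial.eval_X]; lia)

theorem exists_runs_iterate_seek (hu : ∀ n G, Relator.RightUnique (R n G))
    (hR : PolyDecidable fun n G (y : Fin 4 → Fin n) => R n G (y 0, y 1) (y 2, y 3))
    (hP : PolyDecidable fun n G (y : Option (Option ι) → Fin n) =>
      P n G (fun i => y (some (some i))) (y (some none), y none))
    (r : ι → ℕ) (k : ℕ) : ∃ (p : CounterProg (Option Bool)) (B : Polynomial ℕ),
      ∀ n G y x c, Stores n r k y x →
        Runs (encodeGraph ⟨n, G⟩) p ⟨false, 0, dartState k x c⟩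
          ⟨false, 0, dartState k x ((seek (R n G) (P n G y))^[n * n] c)⟩ (B.eval n) := by
  obtain ⟨p, B, hp⟩ := exists_runs_seek hu hR hP r k
  refine ⟨iter 0 (k + 3) (k + 5) (iter 0 (k + 4) (k + 5) p),
    .X * (9 + (.X * (9 + B) + 3)) + 3, fun n G y x c hx => ?_⟩
  have hinner (c u) : Runs (encodeGraph ⟨n, G⟩) (iter 0 (k + 4) (k + 5) p)
      ⟨false, 0, update (dartState k x c) (k + 3) u⟩
      ⟨false, 0, update (dartState k x ((seek (R n G) (P n G y))^[n] c)) (k + 3) u⟩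
      (n * (9 + B.eval n) + 3) := by
    refine Runs.iter (fun a => ⟨false, 0,
      update (dartState k x ((seek (R n G) (P n G y))^[a] c)) (k + 3) u⟩) (by lia) (by lia)
      (by lia) ?_ ?_ ?_ ?_ fun a _ v _ => ?_
    · simp [dartState, hx.zero]
    · simp [dartState, hx.free (k + 5) (by lia)]
    · simp [dartState, hx.free (k + 4) (by lia)]
    · simp [dartState, hx.free (k + 4) (by lia)]
    · rw [iterate_succ_apply']
      exact hp n G y x _ u v hx
  have houter := Runs.iter (w := encodeGraph ⟨n, G⟩) (i := 0) (u := k + 3) (t := k + 5) (m := n)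
    (p := iter 0 (k + 4) (k + 5) p) (T := n * (9 + B.eval n) + 3)
    (fun a => ⟨false, 0, dartState k x ((seek (R n G) (P n G y))^[n * a] c)⟩) (by lia) (by lia)
    (by lia) (by simp [dartState, hx.zero]) (by simp [dartState, hx.free (k + 5) (by lia)])
    (by simp [dartState, hx.free (k + 3) (by lia)]) (by simp [dartState, hx.free (k + 3) (by lia)])
    fun a _ v _ => by
      rw [Nat.mul_succ, add_comm (n * a), iterate_add_apply]
      exact hinner _ v
  simpa using houter

protected theorem reflTransGen (hu : ∀ n G, Relator.RightUnique (R n G))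
    (hR : PolyDecidable fun n G (y : Fin 4 → Fin n) => R n G (y 0, y 1) (y 2, y 3))
    (hP : PolyDecidable fun n G (y : Option (Option ι) → Fin n) =>
      P n G (fun i => y (some (some i))) (y (some none), y none)) (i j : ι) :
    PolyDecidable fun n G y =>
      ∃ e, Relation.ReflTransGen (R n G) (y i, y j) e ∧ P n G y e := by
  intro r k
  obtain ⟨p, B, hp⟩ := exists_runs_iterate_seek hu hR hP r k
  obtain ⟨q, C, hq⟩ := hP (fun i => i.elim (k + 2) fun i => i.elim (k + 1) r) (k + 2)
  refine ⟨.seq (copy (r i) (k + 1) (k + 2)) <| .seq (copy (r j) (k + 2) (k + 3)) <|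
    .seq (.setFlag false) <| .seq p <| .seq q <| .seq (clear (k + 1)) (clear (k + 2)),
    18 * .X + 7 + B + C, fun n G y x hx b => ?_⟩
  have hfst := hx.runs_copy (w := encodeGraph ⟨n, G⟩) i b 0
  have hsnd := (hx.update k.lt_succ_self le_rfl (y i)).runs_copy (w := encodeGraph ⟨n, G⟩) j b 0
  have hseek := hp n G y x (y i, y j) hx
  set c := (seek (R n G) (P n G y))^[n * n] (y i, y j) with hc
  have hiff : (∃ e, Relation.ReflTransGen (R n G) (y i, y j) e ∧ P n G y e) ↔ P n G y c := by
    simpa [hc] using exists_reflTransGen_iff_iterate_seek (P := P n G y) (c := (y i, y j)) (hu n G)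
  have htest := (hq n G _ _ ((hx.push c.1).push c.2)).congr hiff
  refine (hfst.seq (hsnd.seq ((Runs.setFlag _ _ _ _).seq (hseek.seq ((htest _).seq
    ((runs_clear (k + 1) _ _ _).seq (runs_clear (k + 2) _ _ _))))))).congr (fun _ => rfl)
    (fun a => ?_) ?_
  · have h₁ := hx.free (k + 1) (by lia)
    have h₂ := hx.free (k + 2) (by lia)
    simp only [update_apply]
    grind
  · simp only [ne_eq, Nat.left_eq_add, one_ne_zero, not_false_eq_true, update_of_ne, update_self,
      Nat.add_left_cancel_iff, OfNat.ofNat_ne_one, Polynomial.eval_add, Polynomial.eval_mul,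
      Polynomial.eval_ofNat, Polynomial.eval_X]
    lia

end ReflTransGen

end PolyDecidable

theorem exists_runs_count_vertices : ∃ (p : CounterProg (Option Bool)) (B : Polynomial ℕ),
    ∀ G : LabelledGraph, Runs (encodeGraph G) p ⟨false, 0, 0⟩ ⟨false, 0, update 0 0 G.1⟩
      (B.eval G.1) := by
  refine ⟨.seq (countSymbol 0 none) (iter 0 1 3 (.seq .left (iter 0 2 3 .left))),
    .X * (.X + 1) * 4 + 1 + (.X * (.X * 10 + 13) + 3), fun G => ?_⟩
  have hcount := runs_countSymbol (encodeGraph G) (i := 0) (x := 0) rfl none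
  have hrewind := Moves.iter (w := encodeGraph G) (x := update 0 0 G.1) (i := 0) (u := 1) (t := 3)
    (p := .seq (iter 0 2 3 .right) .right) (q := .seq .left (iter 0 2 3 .left)) (m := G.1 + 1)
    (T := G.1 * 10 + 4) (by lia) (by lia) (by lia) (by simp) (by simp) fun v _ => by
      simpa using moves_row (x := update (update 0 0 G.1) 1 v) (w := encodeGraph G) (u := 2)
        (t := 3) (by lia) (by lia) (by lia) (by simp) (by simp)
  have hlen := length_encodeGraph G
  have hback := (hrewind false 0 (by simp [hlen])).2
  rw [update_self, zero_add, ← hlen] at hback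
  rw [count_none_encodeGraph] at hcount
  refine (hcount.seq hback).mono ?_
  simp only [hlen, Polynomial.eval_add, Polynomial.eval_mul, Polynomial.eval_ofNat,
    Polynomial.eval_X, Polynomial.eval_one]
  lia

theorem monotone_polynomial_eval (B : Polynomial ℕ) : Monotone fun n => B.eval n := by
  intro m n h
  simp only [Polynomial.eval_eq_sum, Polynomial.sum]
  gcongr

theorem PolynomiallySolvableOn.congr {P Q Q' : LabelledGraph → Prop}
    (hQ : PolynomiallySolvableOn P Q) (h : ∀ G, P G → (Q' G ↔ Q G)) :
    PolynomiallySolvableOn P Q' := by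
  obtain ⟨answer, hanswer, hM⟩ := hQ
  exact ⟨answer, fun G => (hanswer G).trans (h G.1 G.2).symm, hM⟩

theorem PolyDecidable.polynomiallySolvableOn {Q : ∀ n, SimpleGraph (Fin n) → Prop}
    (hQ : PolyDecidable fun n G (_ : Empty → Fin n) => Q n G) (P : LabelledGraph → Prop) :
    PolynomiallySolvableOn P fun G => Q G.1 G.2 := by
  classical
  obtain ⟨p, B, hp⟩ := exists_runs_count_vertices
  obtain ⟨q, C, hq⟩ := hQ Empty.elim 0
  let D : Polynomial ℕ := B + C + 2 * .X + 1
  have hrun (G : LabelledGraph) : Runs (encodeGraph G) (.seq p (.seq q (clear 0))) ⟨false, 0, 0⟩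
      ⟨decide (Q G.1 G.2), 0, 0⟩ (D.eval (encodeGraph G).length) := by
    have hstores : Stores G.1 Empty.elim 0 Empty.elim (update 0 0 G.1) :=
      ⟨update_self .., fun i => i.elim, fun i => i.elim, fun j hj => by simp [hj.ne']⟩
    refine ((hp G).seq (((hq G.1 G.2 _ _ hstores).runs false).seq (runs_clear 0 _ 0 _))).congr
      (fun _ => rfl) (by simp) ?_
    have hle : G.1 ≤ (encodeGraph G).length := by
      rw [length_encodeGraph]
      exact Nat.le_mul_of_pos_right _ G.1.succ_pos
    have hB := monotone_polynomial_eval B hle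
    have hC := monotone_polynomial_eval C hle
    simp only [update_self, Polynomial.eval_add, Polynomial.eval_mul, Polynomial.eval_ofNat,
      Polynomial.eval_X, Polynomial.eval_one, D] at hB hC ⊢
    lia
  refine ⟨fun G => decide (Q G.1.1 G.1.2), fun G => decide_eq_true_iff, ⟨{
    tm := machine (.seq p (.seq q (clear 0)))
    inputAlphabet := Equiv.refl _
    outputAlphabet := Equiv.refl _
    time := .X + 1 + D
    outputsFun := fun G => ?_ }⟩⟩
  have htime : (.X + 1 + D : Polynomial ℕ).eval (encodeGraph G.1).length =
      (encodeGraph G.1).length + 1 + D.eval (encodeGraph G.1).length := by simp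
  exact (List.map_id (encodeGraph G.1)).symm ▸ htime ▸ (hrun G.1).machine_outputs.some

end PolyDecidable

end CounterPrograms

namespace DynamicColoring

section Neighbours

variable {V : Type*} {G : SimpleGraph V} {u v a b c d : V}

/-- The degree of `v` as the cardinality of its set of neighbours, which needs no decidability
instance; it is `0` for a vertex with infinitely many neighbours. -/
noncomputable def ndeg (G : SimpleGraph V) (v : V) : ℕ :=
  (G.neighborSet v).ncard

theorem degree_eq_ndeg (v : V) [Fintype (G.neighborSet v)] : G.degree v = ndeg G v := by
  rw [ndeg, Set.ncard_eq_toFinset_card', ← G.card_neighborSet_eq_degree, Set.toFinset_card]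

theorem exists_adj_pair_of_two_le_ndeg (hv : 2 ≤ ndeg G v) :
    ∃ a b, G.Adj v a ∧ G.Adj v b ∧ a ≠ b := by
  obtain ⟨a, ha, b, hb, hab⟩ :=
    (Set.one_lt_ncard (Set.finite_of_ncard_pos (by unfold ndeg at hv; omega))).1 hv
  exact ⟨a, b, ha, hb, hab⟩

theorem exists_adj_ne_ne_of_three_le_ndeg (hv : 3 ≤ ndeg G v) (a b : V) :
    ∃ c, G.Adj v c ∧ c ≠ a ∧ c ≠ b := by
  have hcard : ({a, b} : Set V).ncard ≤ 2 := by
    simpa using Set.ncard_insert_le a {b}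
  obtain ⟨c, hc, hab⟩ := Set.exists_mem_notMem_of_ncard_lt_ncard
    (s := {a, b}) (t := G.neighborSet v) (hcard.trans_lt hv) (Set.toFinite _)
  exact ⟨c, hc, by simpa [not_or] using hab⟩

theorem eq_or_eq_of_ndeg_eq_two (hv : ndeg G v = 2) (ha : G.Adj v a) (hb : G.Adj v b)
    (hab : a ≠ b) (hc : G.Adj v c) : c = a ∨ c = b := by
  have hsub : {a, b} ⊆ G.neighborSet v := Set.insert_subset ha (Set.singleton_subset_iff.2 hb)
  have heq := Set.eq_of_subset_of_ncard_le hsub (by rw [Set.ncard_pair hab]; exact hv.le)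
    (Set.finite_of_ncard_pos (by unfold ndeg at hv; omega))
  exact heq.ge hc

theorem eq_or_eq_or_eq_of_ndeg_le_three [Finite V] (hv : ndeg G v ≤ 3) (ha : G.Adj v a)
    (hb : G.Adj v b) (hc : G.Adj v c) (hab : a ≠ b) (hac : a ≠ c) (hbc : b ≠ c)
    (hd : G.Adj v d) : d = a ∨ d = b ∨ d = c := by
  by_contra! hne
  have hsub : {d, a, b, c} ⊆ G.neighborSet v := by
    rintro z (rfl | rfl | rfl | rfl) <;> assumption
  have := (Set.ncard_le_ncard hsub (Set.toFinite _)).trans hv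
  rw [Set.ncard_insert_of_notMem (by simp [hne]),
    Set.ncard_eq_three.2 ⟨a, b, c, hab, hac, hbc, rfl⟩] at this
  omega

theorem two_le_ndeg [Finite V] (ha : G.Adj v a) (hb : G.Adj v b) (hab : a ≠ b) : 2 ≤ ndeg G v :=
  (Set.one_lt_ncard (Set.toFinite _)).2 ⟨a, ha, b, hb, hab⟩

theorem three_le_ndeg [Finite V] (ha : G.Adj v a) (hb : G.Adj v b) (hc : G.Adj v c) (hab : a ≠ b)
    (hac : a ≠ c) (hbc : b ≠ c) : 3 ≤ ndeg G v :=
  (Set.two_lt_ncard (Set.toFinite _)).2 ⟨a, ha, b, hb, c, hc, hab, hac, hbc⟩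

end Neighbours

theorem exists_triangle_of_isClawFree {V : Type} {G : SimpleGraph V} (hG : IsClawFree G) {v : V}
    (hv : ndeg G v = 3) : ∃ a b, G.Adj v a ∧ G.Adj v b ∧ G.Adj a b := by
  by_contra! hind
  obtain ⟨x, y, z, hxy, hxz, hyz, hN⟩ := Set.ncard_eq_three.1 hv
  let leaf : Fin 3 → V := ![x, y, z]
  have hleaf : ∀ i, G.Adj v (leaf i) := by
    have hmem : ∀ w, w ∈ G.neighborSet v ↔ w = x ∨ w = y ∨ w = z := by simp [hN]
    intro i
    refine (hmem _).2 ?_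
    fin_cases i <;> simp [leaf]
  have hinj : Function.Injective leaf := by
    intro i j hij
    fin_cases i <;> fin_cases j <;> simp_all [leaf]
  refine hG ⟨⟨⟨Sum.elim (fun _ => v) leaf, ?_⟩, ?_⟩⟩
  · exact (Function.injective_of_subsingleton _).sumElim hinj fun _ i => (hleaf i).ne
  · rintro (i | i) (j | j)
    · simp
    · simp [hleaf]
    · simp [(hleaf _).symm]
    · simp [hind _ _ (hleaf i) (hleaf j)]

section ChromaticNumber

variable {V : Type*}

/-- A proper colouring with the colours `0, 1, 2` in which the two neighbours of a vertex of degree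
two have different colours. When every vertex of degree three lies in a triangle, these are the
dynamic colourings with three colours, not all of which need to occur. -/
def IsDynamicThreeColoring (G : SimpleGraph V) (c : V → ZMod 3) : Prop :=
  (∀ u v, G.Adj u v → c u ≠ c v) ∧
    ∀ v u w, ndeg G v = 2 → G.Adj v u → G.Adj v w → u ≠ w → c u ≠ c w

theorem exists_isDynamicColoring {V : Type} [Fintype V] (G : SimpleGraph V) :
    ∃ c : V → Fin (dynamicChromaticNumber G), IsDynamicColoring G c := by
  classical
  refine Nat.sInf_mem (s := {k | ∃ c : V → Fin k, IsDynamicColoring G c})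
    ⟨Fintype.card V, Fintype.equivFin V, (Fintype.equivFin V).surjective,
      fun u v h => (Fintype.equivFin V).injective.ne h.ne, fun v => ?_⟩
  rw [Set.ncard_image_of_injective _ (Fintype.equivFin V).injective, degree_eq_ndeg]
  exact min_le_left _ _

theorem dynamicChromaticNumber_le_iff {V : Type} [Fintype V] {G : SimpleGraph V} {k : ℕ} :
    dynamicChromaticNumber G ≤ k ↔ ∃ c : V → Fin k, (∀ u v, G.Adj u v → c u ≠ c v) ∧
      ∀ v, min (ndeg G v) 2 ≤ (c '' G.neighborSet v).ncard := by
  classical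
  constructor
  · intro hk
    obtain ⟨c, -, hproper, hdyn⟩ := exists_isDynamicColoring G
    have hinj := Fin.castLE_injective hk
    refine ⟨Fin.castLE hk ∘ c, fun u v h => hinj.ne (hproper u v h), fun v => ?_⟩
    rw [Set.image_comp, Set.ncard_image_of_injective _ hinj]
    simpa only [degree_eq_ndeg] using hdyn v
  · rintro ⟨c, hproper, hdyn⟩
    let e : Set.range c ≃ Fin (Nat.card (Set.range c)) := Finite.equivFin _
    have hcard : Nat.card (Set.range c) ≤ k :=
      (Nat.card_le_card_of_injective _ Subtype.val_injective).trans_eq (Nat.card_fin k)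
    suffices hdc : IsDynamicColoring G (e ∘ Set.rangeFactorization c) from
      (Nat.sInf_le ⟨_, hdc⟩ : dynamicChromaticNumber G ≤ _).trans hcard
    refine ⟨?_, ?_, ?_⟩
    · exact e.surjective.comp Set.rangeFactorization_surjective
    · exact fun u v h heq => hproper u v h (congrArg Subtype.val (e.injective heq))
    · intro v
      have himage : Subtype.val '' (Set.rangeFactorization c '' G.neighborSet v) =
          c '' G.neighborSet v := by
        rw [← Set.image_comp]
        rfl
      rw [Set.image_comp, Set.ncard_image_of_injective _ e.injective,
        ← Set.ncard_image_of_injective _ Subtype.val_injective, himage]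
      simpa only [degree_eq_ndeg] using hdyn v

theorem dynamicChromaticNumber_le_three_iff {V : Type} [Fintype V] {G : SimpleGraph V}
    (htri : ∀ v, 3 ≤ ndeg G v → ∃ a b, G.Adj v a ∧ G.Adj v b ∧ G.Adj a b) :
    dynamicChromaticNumber G ≤ 3 ↔ ∃ c, IsDynamicThreeColoring G c := by
  classical
  rw [dynamicChromaticNumber_le_iff]
  refine exists_congr fun c : V → Fin 3 => and_congr_right fun hproper => ?_
  constructor
  · intro hdyn v u w hv hu hw huw heq
    have himage : c '' G.neighborSet v ⊆ {c u} := by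
      rintro _ ⟨z, hz, rfl⟩
      rcases eq_or_eq_of_ndeg_eq_two hv hu hw huw hz with rfl | rfl
      exacts [rfl, heq.symm]
    have := (hdyn v).trans (Set.ncard_le_ncard himage)
    simp [hv] at this
  · intro hdyn v
    obtain hv | hv : ndeg G v ≤ 1 ∨ 2 ≤ ndeg G v := by omega
    · obtain hN | ⟨a, ha⟩ := (Set.ncard_le_one_iff_eq (Set.toFinite _)).1 hv
      · simp [ndeg, hN]
      · simp [ndeg, ha]
    · obtain ⟨a, b, ha, hb, hab⟩ : ∃ a b, G.Adj v a ∧ G.Adj v b ∧ c a ≠ c b := by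
        obtain hv | hv := hv.eq_or_lt'
        · obtain ⟨a, b, ha, hb, hab⟩ := exists_adj_pair_of_two_le_ndeg hv.ge
          exact ⟨a, b, ha, hb, hdyn v a b hv ha hb hab⟩
        · obtain ⟨a, b, ha, hb, hab⟩ := htri v hv
          exact ⟨a, b, ha, hb, hproper a b hab⟩
      exact (min_le_right _ _).trans ((Set.one_lt_ncard (Set.toFinite _)).2
        ⟨c a, ⟨a, ha, rfl⟩, c b, ⟨b, hb, rfl⟩, hab⟩)

end ChromaticNumber

section Threads

variable {V : Type*} {G : SimpleGraph V} {d d' e e' f : V × V} {k l : ℕ}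

/-- The dart `e` continues the dart `d` through a vertex of degree two. A dart is an ordered pair
`(u, v)` of adjacent vertices, directed towards `v`. -/
def DartStep (G : SimpleGraph V) (d e : V × V) : Prop :=
  e.1 = d.2 ∧ G.Adj d.1 d.2 ∧ G.Adj e.1 e.2 ∧ e.2 ≠ d.1 ∧ ndeg G d.2 = 2

/-- The dart `e` is reached from the dart `d` by `k` steps through vertices of degree two. -/
def DartWalk (G : SimpleGraph V) : ℕ → V × V → V × V → Prop
  | 0, d, e => d = e
  | k + 1, d, e => ∃ d', DartStep G d d' ∧ DartWalk G k d' e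

theorem DartStep.fst_eq (h : DartStep G d e) : e.1 = d.2 := h.1

theorem DartStep.adj_left (h : DartStep G d e) : G.Adj d.1 d.2 := h.2.1

theorem DartStep.adj_right (h : DartStep G d e) : G.Adj e.1 e.2 := h.2.2.1

theorem DartStep.snd_ne (h : DartStep G d e) : e.2 ≠ d.1 := h.2.2.2.1

theorem DartStep.ndeg_eq (h : DartStep G d e) : ndeg G d.2 = 2 := h.2.2.2.2

theorem DartStep.swap (h : DartStep G d e) : DartStep G e.swap d.swap :=
  ⟨h.fst_eq.symm, h.adj_right.symm, h.adj_left.symm, h.snd_ne.symm, by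
    simpa [h.fst_eq] using h.ndeg_eq⟩

theorem DartStep.unique (h : DartStep G d e) (h' : DartStep G d e') : e = e' := by
  refine Prod.ext (h.fst_eq.trans h'.fst_eq.symm) ?_
  exact ((eq_or_eq_of_ndeg_eq_two h.ndeg_eq (h'.fst_eq ▸ h'.adj_right) h.adj_left.symm h'.snd_ne
    (h.fst_eq ▸ h.adj_right)).resolve_right h.snd_ne)

theorem DartStep.unique_left (h : DartStep G d e) (h' : DartStep G d' e) : d = d' :=
  Prod.swap_injective (h.swap.unique h'.swap)

theorem DartStep.dartWalk (h : DartStep G d e) : DartWalk G 1 d e := ⟨e, h, rfl⟩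

theorem DartWalk.trans (h : DartWalk G k d e) (h' : DartWalk G l e f) :
    DartWalk G (k + l) d f := by
  induction k generalizing d with
  | zero =>
    cases h
    simpa using h'
  | succ k ih =>
    obtain ⟨d', hstep, hwalk⟩ := h
    rw [Nat.succ_add]
    exact ⟨d', hstep, ih hwalk⟩

theorem DartWalk.snoc (h : DartWalk G k d e) (h' : DartStep G e f) : DartWalk G (k + 1) d f :=
  h.trans h'.dartWalk

theorem DartWalk.swap (h : DartWalk G k d e) : DartWalk G k e.swap d.swap := by
  induction k generalizing d with
  | zero =>
    cases h
    rfl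
  | succ k ih =>
    obtain ⟨d', hstep, hwalk⟩ := h
    exact (ih hwalk).snoc hstep.swap

theorem DartWalk.exists_split (h : DartWalk G (k + l) d e) :
    ∃ f, DartWalk G k d f ∧ DartWalk G l f e := by
  induction k generalizing d with
  | zero => exact ⟨d, rfl, by simpa using h⟩
  | succ k ih =>
    rw [Nat.succ_add] at h
    obtain ⟨d', hstep, hwalk⟩ := h
    obtain ⟨f, hf, hfe⟩ := ih hwalk
    exact ⟨f, ⟨d', hstep, hf⟩, hfe⟩

theorem DartWalk.exists_snoc (h : DartWalk G (k + 1) d e) :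
    ∃ e', DartWalk G k d e' ∧ DartStep G e' e := by
  obtain ⟨e', hwalk, _, hstep, rfl⟩ := h.exists_split
  exact ⟨e', hwalk, hstep⟩

theorem DartWalk.unique (h : DartWalk G k d e) (h' : DartWalk G k d e') : e = e' := by
  induction k generalizing d with
  | zero => exact h.symm.trans h'
  | succ k ih =>
    obtain ⟨d₁, hstep, hwalk⟩ := h
    obtain ⟨d₂, hstep', hwalk'⟩ := h'
    cases hstep.unique hstep'
    exact ih hwalk hwalk'

theorem DartWalk.adj (h : DartWalk G k d e) (hd : G.Adj d.1 d.2) : G.Adj e.1 e.2 := by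
  cases k with
  | zero => exact h ▸ hd
  | succ k =>
    obtain ⟨_, _, hstep⟩ := h.exists_snoc
    exact hstep.adj_right

theorem DartWalk.le_of_ndeg_ne_two (h : DartWalk G k d e) (he : ndeg G e.2 ≠ 2)
    (h' : DartWalk G l d f) : l ≤ k := by
  by_contra! hlt
  obtain ⟨m, rfl⟩ := Nat.exists_eq_add_of_lt hlt
  obtain ⟨f', hwalk, _, hstep, -⟩ := (show DartWalk G (k + (m + 1)) d f from h').exists_split
  cases h.unique hwalk
  exact he hstep.ndeg_eq

theorem DartWalk.unique_end (h : DartWalk G k d e) (he : ndeg G e.2 ≠ 2)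
    (h' : DartWalk G l d f) (hf : ndeg G f.2 ≠ 2) : k = l ∧ e = f := by
  obtain rfl : k = l := (h'.le_of_ndeg_ne_two hf h).antisymm (h.le_of_ndeg_ne_two he h')
  exact ⟨rfl, h.unique h'⟩

theorem not_dartWalk_swap (hd : G.Adj d.1 d.2) : ¬ DartWalk G k d d.swap := by
  induction k using Nat.twoStepInduction generalizing d with
  | zero => exact fun h => hd.ne (congrArg Prod.fst h)
  | one =>
    rintro ⟨_, hstep, rfl⟩
    exact hstep.snd_ne rfl
  | more k ih _ =>
    rintro ⟨e, hstep, hwalk⟩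
    obtain ⟨e', hwalk', hstep'⟩ := hwalk.exists_snoc
    obtain rfl : e' = e.swap := hstep'.unique_left hstep.swap
    exact ih hstep.adj_right hwalk'

/-- The two vertices are equal, or they are the ends of a diamond (`K₄` minus an edge); in both
cases every proper colouring with three colours gives them the same colour. -/
def ForcedEqual (G : SimpleGraph V) (u w : V) : Prop :=
  u = w ∨ ∃ a b, G.Adj a b ∧ G.Adj u a ∧ G.Adj u b ∧ G.Adj w a ∧ G.Adj w b

/-- Every walk through vertices of degree two whose first and last vertices are forced to have the
same colour has length divisible by three. This turns out to be the only obstruction to a dynamic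
colouring with three colours. -/
def ThreadCondition (G : SimpleGraph V) : Prop :=
  ∀ u x y w k, G.Adj u x → DartWalk G k (u, x) (y, w) → ForcedEqual G u w → 3 ∣ k + 1

theorem ThreadCondition.dvd_of_dartWalk_self (hG : ThreadCondition G) (h : DartWalk G k d d) :
    3 ∣ k := by
  cases k with
  | zero => exact dvd_zero 3
  | succ k =>
    obtain ⟨⟨y, w⟩, hwalk, hstep⟩ := h.exists_snoc
    exact hG d.1 d.2 y w k hstep.adj_right hwalk (.inl hstep.fst_eq)

theorem IsDynamicThreeColoring.sub_eq_of_dartStep {c : V → ZMod 3}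
    (hc : IsDynamicThreeColoring G c) (h : DartStep G d e) : c e.2 - c e.1 = c d.2 - c d.1 := by
  have hsub : ∀ x y z : ZMod 3, x ≠ y → y ≠ z → x ≠ z → z - y = y - x := by decide
  obtain ⟨h1, h2, h3, h4, h5⟩ := h
  rw [h1] at h3 ⊢
  exact hsub _ _ _ (hc.1 _ _ h2) (hc.1 _ _ h3) (hc.2 _ _ _ h5 h2.symm h3 h4.symm)

theorem IsDynamicThreeColoring.apply_of_dartWalk {c : V → ZMod 3}
    (hc : IsDynamicThreeColoring G c) (h : DartWalk G k d e) :
    c e.2 = c d.1 + (k + 1 : ℕ) * (c d.2 - c d.1) := by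
  induction k generalizing d with
  | zero =>
    cases h
    push_cast
    ring
  | succ k ih =>
    obtain ⟨d', hstep, hwalk⟩ := h
    rw [ih hwalk, hc.sub_eq_of_dartStep hstep, hstep.fst_eq]
    push_cast
    ring

theorem ForcedEqual.apply_eq {u w : V} (h : ForcedEqual G u w) {c : V → ZMod 3}
    (hc : ∀ u v, G.Adj u v → c u ≠ c v) : c u = c w := by
  have heq : ∀ a b x y : ZMod 3, a ≠ b → (x ≠ a ∧ x ≠ b) → (y ≠ a ∧ y ≠ b) → x = y := by decide
  obtain rfl | ⟨a, b, hab, hua, hub, hwa, hwb⟩ := h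
  · rfl
  · exact heq _ _ _ _ (hc a b hab) ⟨hc u a hua, hc u b hub⟩ ⟨hc w a hwa, hc w b hwb⟩

theorem IsDynamicThreeColoring.threadCondition {c : V → ZMod 3}
    (hc : IsDynamicThreeColoring G c) : ThreadCondition G := by
  intro u x y w k hux hwalk hforced
  have hzero : ∀ m e : ZMod 3, e ≠ 0 → m * e = 0 → m = 0 := by decide
  have hend := hc.apply_of_dartWalk hwalk
  rw [← hforced.apply_eq hc.1, left_eq_add] at hend
  exact (ZMod.natCast_eq_zero_iff _ 3).1 (hzero _ _ (sub_ne_zero.2 (hc.1 u x hux).symm) hend)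

end Threads

section Paths

variable {V : Type*} {G : SimpleGraph V} {u w x y z : V} {i k : ℕ}

theorem DartWalk.snd_ne_of_dartStep (h : DartWalk G k (u, x) (y, w)) (hw : ndeg G w ≠ 2)
    {e : V × V} (hz : DartStep G (z, u) (u, x)) (hi : DartWalk G i (u, x) e) : e.2 ≠ u := by
  obtain ⟨z', u'⟩ := e
  rintro rfl
  obtain rfl | rfl := eq_or_eq_of_ndeg_eq_two hz.ndeg_eq hz.adj_left.symm hz.adj_right
    hz.snd_ne.symm (hi.adj hz.adj_right).symm
  · have := h.le_of_ndeg_ne_two hw ((hi.snoc hz).trans h)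
    omega
  · exact not_dartWalk_swap hz.adj_right hi

theorem DartWalk.exists_isPath (h : DartWalk G k (u, x) (y, w)) (hux : G.Adj u x)
    (hw : ndeg G w ≠ 2) (hu : ∀ i e, DartWalk G i (u, x) e → e.2 ≠ u) :
    ∃ p : G.Walk u w, p.IsPath ∧ p.support.length = k + 2 ∧
      ∀ z ∈ p.support, z = u ∨ ∃ i z', DartWalk G i (u, x) (z', z) := by
  induction k generalizing u x with
  | zero =>
    cases h
    exact ⟨hux.toWalk, by simp [hux.ne], rfl, by simpa using .inr ⟨0, y, rfl⟩⟩
  | succ k ih =>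
    obtain ⟨⟨x', x₂⟩, hstep, hwalk⟩ := h
    obtain rfl : x' = x := hstep.fst_eq
    obtain ⟨p, hp, hlen, hsupp⟩ := ih hwalk hstep.adj_right
      fun i e hi => hwalk.snd_ne_of_dartStep hw hstep hi
    have hsupp' : ∀ z ∈ p.support, ∃ i z', DartWalk G i (u, x') (z', z) := by
      intro z hz
      obtain rfl | ⟨i, z', hi⟩ := hsupp z hz
      exacts [⟨0, u, rfl⟩, ⟨i + 1, z', _, hstep, hi⟩]
    refine ⟨.cons hux p, hp.cons fun hmem => ?_, by simp [hlen], ?_⟩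
    · obtain ⟨i, z', hi⟩ := hsupp' u hmem
      exact hu i _ hi rfl
    · simpa using fun z hz => .inr (hsupp' z hz)

/-- The consequences of membership in the class `𝒞` on which the colouring argument rests:
claw-freeness puts the vertices of degree three into triangles, and the exclusion of the `A_i` with
`i = 3j + 1` bounds the lengths of the paths that link them. -/
structure IsTame (G : SimpleGraph V) : Prop where
  ndeg_le : ∀ v, ndeg G v ≤ 3
  exists_triangle : ∀ v, ndeg G v = 3 → ∃ a b, G.Adj v a ∧ G.Adj v b ∧ G.Adj a b
  not_dvd : ∀ u x y w k, u ≠ w → ndeg G u = 3 → ndeg G w = 3 → G.Adj u x →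
    DartWalk G k (u, x) (y, w) → ¬ 3 ∣ k + 1

theorem isTame_of_inClassC {V : Type} [Fintype V] {G : SimpleGraph V} (h : InClassC G) :
    IsTame G where
  ndeg_le v := by
    classical
    rw [← degree_eq_ndeg]
    convert (G.degree_le_maxDegree v).trans h.1
  exists_triangle v hv := exists_triangle_of_isClawFree h.2.1 hv
  not_dvd u x y w k huw hu hw hux hwalk hdvd := by
    have hmax : ∀ i e, DartWalk G i (u, x) e → ndeg G e.2 ≠ 2 → e.2 = w := fun i e hi he =>
      congrArg Prod.snd (hi.unique_end he hwalk (by simp [hw])).2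
    obtain ⟨p, hp, hlen, hsupp⟩ := hwalk.exists_isPath hux (by simp [hw])
      fun i e hi he => huw (he ▸ hmax i e hi (by simp [he, hu]))
    obtain ⟨j, hj⟩ := hdvd
    refine h.2.2 j (by omega) u w p ⟨hp, by omega, ?_, ?_, fun z hz hzu hzw => ?_⟩ <;>
      rw [degree_eq_ndeg]
    · exact hu
    · exact hw
    · obtain ⟨i, z', hi⟩ := (hsupp z hz).resolve_left hzu
      by_contra hz2
      exact hzw (hmax i _ hi hz2)

end Paths

section Coloring

variable {V : Type*} {H K M : SimpleGraph V} {S T : Set V} {f g : V → ZMod 3}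

/-- The map `f` is a proper colouring, with the colours `0, 1, 2`, of the subgraph of `H` induced by
`S`; its values outside `S` are irrelevant. -/
def IsProperOn (H : SimpleGraph V) (S : Set V) (f : V → ZMod 3) : Prop :=
  ∀ u ∈ S, ∀ v ∈ S, H.Adj u v → f u ≠ f v

theorem IsProperOn.extend (hf : IsProperOn H (S \ T) f) (hfg : ∀ v ∉ T, g v = f v)
    (hT : ∀ u ∈ T, ∀ v ∈ S, H.Adj u v → g u ≠ g v) : IsProperOn H S g := by
  intro u hu v hv huv
  by_cases huT : u ∈ T
  · exact hT u huT v hv huv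
  by_cases hvT : v ∈ T
  · exact (hT v hvT u hu huv.symm).symm
  rw [hfg u huT, hfg v hvT]
  exact hf u ⟨hu, huT⟩ v ⟨hv, hvT⟩ huv

theorem IsProperOn.exists_extend_independent (hf : IsProperOn H (S \ T) f)
    (hT : ∀ u ∈ T, ∀ v ∈ T, ¬ H.Adj u v) {α β : ZMod 3}
    (hαβ : ∀ u ∈ T, ∀ v ∈ S \ T, H.Adj u v → f v = α ∨ f v = β) :
    ∃ g, IsProperOn H S g ∧ (∀ v ∉ T, g v = f v) ∧ ∀ u ∈ T, ∀ v ∈ T, g u = g v := by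
  classical
  have hfree : ∀ α β : ZMod 3, ∃ γ, γ ≠ α ∧ γ ≠ β := by decide
  obtain ⟨γ, hγα, hγβ⟩ := hfree α β
  have hoff : ∀ v ∉ T, T.piecewise (fun _ => γ) f v = f v := fun v hv =>
    Set.piecewise_eq_of_notMem T _ _ hv
  have hon : ∀ v ∈ T, T.piecewise (fun _ => γ) f v = γ := fun v hv =>
    Set.piecewise_eq_of_mem T _ _ hv
  refine ⟨T.piecewise (fun _ => γ) f, hf.extend hoff fun u hu v hv huv => ?_, hoff,
    fun u hu v hv => (hon u hu).trans (hon v hv).symm⟩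
  have hvT : v ∉ T := fun hvT => hT u hu v hvT huv
  rw [hon u hu, hoff v hvT]
  obtain h | h := hαβ u hu v ⟨hv, hvT⟩ huv <;> rwa [h]

theorem IsProperOn.exists_extend_vertex {v p q : V} (hf : IsProperOn H (S \ {v}) f)
    (hv : ∀ w ∈ S, H.Adj v w → w = p ∨ w = q) : ∃ g, IsProperOn H S g := by
  obtain ⟨g, hg, -⟩ := hf.exists_extend_independent (α := f p) (β := f q) (by simp) (by
    rintro u rfl w hw huw
    exact (hv w hw.1 huw).imp (congrArg f) (congrArg f))
  exact ⟨g, hg⟩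

theorem IsProperOn.exists_extend_triangle {a b c a' b' c' : V}
    (hf : IsProperOn H (S \ {a, b, c}) f) (hab : a ≠ b) (hac : a ≠ c) (hbc : b ≠ c)
    (ha : ∀ w ∈ S \ {a, b, c}, H.Adj a w → w = a') (hb : ∀ w ∈ S \ {a, b, c}, H.Adj b w → w = b')
    (hc : ∀ w ∈ S \ {a, b, c}, H.Adj c w → w = c') (hne : f a' ≠ f b') :
    ∃ g, IsProperOn H S g := by
  classical
  have hfree : ∀ x y z : ZMod 3, x ≠ y →
      ∃ α β γ, (α ≠ β ∧ α ≠ γ ∧ β ≠ γ) ∧ α ≠ x ∧ β ≠ y ∧ γ ≠ z := by decide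
  obtain ⟨α, β, γ, ⟨hαβ, hαγ, hβγ⟩, hα, hβ, hγ⟩ := hfree _ _ (f c') hne
  let g := Function.update (Function.update (Function.update f a α) b β) c γ
  have hga : g a = α := by simp [g, hab, hac]
  have hgb : g b = β := by simp [g, hbc]
  have hgc : g c = γ := by simp [g]
  have hoff : ∀ v ∉ ({a, b, c} : Set V), g v = f v := by
    intro v hv
    simp only [Set.mem_insert_iff, Set.mem_singleton_iff, not_or] at hv
    simp [g, hv]
  refine ⟨g, hf.extend hoff fun u hu v hv huv => ?_⟩
  by_cases hvT : v ∈ ({a, b, c} : Set V)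
  · have := huv.ne
    grind
  · grind

/-- Inside `S`, the edges of `K` form disjoint triangles, edges and isolated vertices, and the edges
of `M` form a matching. -/
structure IsTrianglesMatching (K M : SimpleGraph V) (S : Set V) : Prop where
  exists_pair : ∀ v ∈ S, ∃ p q, ∀ w ∈ S, K.Adj v w → w = p ∨ w = q
  adj_trans : ∀ u ∈ S, ∀ v ∈ S, ∀ w ∈ S, K.Adj u v → K.Adj v w → u ≠ w → K.Adj u w
  eq_of_adj : ∀ u ∈ S, ∀ v ∈ S, ∀ w ∈ S, M.Adj u v → M.Adj u w → v = w

theorem IsTrianglesMatching.mono (h : IsTrianglesMatching K M S) (hTS : T ⊆ S) :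
    IsTrianglesMatching K M T where
  exists_pair v hv := (h.exists_pair v (hTS hv)).imp fun _ => Exists.imp fun _ hpq w hw =>
    hpq w (hTS hw)
  adj_trans u hu v hv w hw := h.adj_trans u (hTS hu) v (hTS hv) w (hTS hw)
  eq_of_adj u hu v hv w hw := h.eq_of_adj u (hTS hu) v (hTS hv) w (hTS hw)

theorem IsTrianglesMatching.sup_edge (h : IsTrianglesMatching K M S) {a b a' b' : V} (ha : a ∈ S)
    (hb : b ∈ S) (haa' : M.Adj a a') (hbb' : M.Adj b b') (haT : a ∈ T) (hbT : b ∈ T) :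
    IsTrianglesMatching K (M ⊔ SimpleGraph.edge a' b') (S \ T) where
  exists_pair := (h.mono Set.sdiff_subset).exists_pair
  adj_trans := (h.mono Set.sdiff_subset).adj_trans
  eq_of_adj := by
    have hmatched : ∀ z z', z ∈ S → z ∈ T → M.Adj z z' → z' ∈ S → ∀ w ∈ S \ T, ¬ M.Adj z' w :=
      fun z z' hz hzT hadj hz' w hw hz'w =>
        hw.2 (h.eq_of_adj z' hz' z hz w hw.1 hadj.symm hz'w ▸ hzT)
    have := hmatched a a' ha haT haa'
    have := hmatched b b' hb hbT hbb'
    intro u hu v hv w hw huv huw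
    have := h.eq_of_adj u hu.1 v hv.1 w hw.1
    simp only [SimpleGraph.sup_adj, SimpleGraph.edge_adj] at huv huw
    grind

theorem IsTrianglesMatching.eq_of_adj_sup (h : IsTrianglesMatching K M S) {v b c v' : V}
    (hv : v ∈ S) (hb : b ∈ S) (hc : c ∈ S) (hv' : v' ∈ S) (hbc : b ≠ c) (hvb : K.Adj v b)
    (hvc : K.Adj v c) (hvv' : M.Adj v v') {w : V} (hw : w ∈ S) (hvw : (K ⊔ M).Adj v w) :
    w = b ∨ w = c ∨ w = v' := by
  obtain ⟨p, q, hpq⟩ := h.exists_pair v hv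
  obtain hvw | hvw := hvw
  · have := hpq b hb hvb
    have := hpq c hc hvc
    have := hpq w hw hvw
    grind
  · exact .inr (.inr (h.eq_of_adj v hv w hw v' hv' hvw hvv'))

theorem IsTrianglesMatching.exists_triangle_and_partner (h : IsTrianglesMatching K M S) {v : V}
    (hv : v ∈ S) (hthree : ∀ p q, ∃ w ∈ S, (K ⊔ M).Adj v w ∧ w ≠ p ∧ w ≠ q) :
    ∃ b ∈ S, ∃ c ∈ S, ∃ v' ∈ S, b ≠ c ∧ K.Adj v b ∧ K.Adj v c ∧ M.Adj v v' ∧ ¬ K.Adj v v' := by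
  simp only [SimpleGraph.sup_adj] at hthree
  have hM := h.eq_of_adj v hv
  obtain ⟨p, q, hpq⟩ := h.exists_pair v hv
  obtain ⟨v', hv', hadj, hne⟩ := hthree p q
  have hKv' : ¬ K.Adj v v' := by grind
  obtain ⟨b, hb, hvb⟩ := hthree v' v'
  obtain ⟨c, hc, hvc⟩ := hthree v' b
  exact ⟨b, hb, c, hc, v', hv', by grind⟩

theorem IsTrianglesMatching.exists_reduction (h : IsTrianglesMatching K M S) {a : V} (ha : a ∈ S)
    (hthree : ∀ v ∈ S, ∀ p q, ∃ w ∈ S, (K ⊔ M).Adj v w ∧ w ≠ p ∧ w ≠ q) :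
    ∃ M' T, a ∈ T ∧ IsTrianglesMatching K M' (S \ T) ∧
      ∀ f, IsProperOn (K ⊔ M') (S \ T) f → ∃ g, IsProperOn (K ⊔ M) S g := by
  obtain ⟨b, hb, c, hc, a', ha', hbc, hab, hac, haa', hKa'⟩ :=
    h.exists_triangle_and_partner ha (hthree a ha)
  have hKbc : K.Adj b c := h.adj_trans b hb a ha c hc hab.symm hac hbc
  obtain ⟨-, -, -, -, b', hb', -, -, -, hbb', hKb'⟩ :=
    h.exists_triangle_and_partner hb (hthree b hb)
  obtain ⟨-, -, -, -, c', hc', -, -, -, hcc', -⟩ :=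
    h.exists_triangle_and_partner hc (hthree c hc)
  -- Joining the partners of `a` and `b` forces a colouring of the rest to separate these partners,
  -- which is what extending it to the triangle needs.
  refine ⟨M ⊔ SimpleGraph.edge a' b', {a, b, c}, by simp,
    h.sup_edge ha hb haa' hbb' (by simp) (by simp), fun f hf => ?_⟩
  have hne : f a' ≠ f b' := by
    have ha'b' : a' ≠ b' := by
      rintro rfl
      exact hab.ne (h.eq_of_adj a' ha' a ha b hb haa'.symm hbb'.symm)
    refine hf a' ⟨ha', ?_⟩ b' ⟨hb', ?_⟩ (.inr (.inr ?_))
    · rintro (rfl | rfl | rfl)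
      exacts [haa'.ne rfl, hKa' hab, hKa' hac]
    · rintro (rfl | rfl | rfl)
      exacts [hKb' hab.symm, hbb'.ne rfl, hKb' hKbc]
    · simp [SimpleGraph.edge_adj, ha'b']
  refine IsProperOn.exists_extend_triangle (fun u hu v hv huv => hf u hu v hv ?_) hab.ne hac.ne
    hbc (a' := a') (b' := b') (c' := c') (fun w hw haw => ?_) (fun w hw hbw => ?_)
    (fun w hw hcw => ?_) hne
  · exact huv.imp_right .inl
  · have := h.eq_of_adj_sup ha hb hc ha' hbc hab hac haa' hw.1 haw
    grind
  · have := h.eq_of_adj_sup hb ha hc hb' hac.ne hab.symm hKbc hbb' hw.1 hbw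
    grind
  · have := h.eq_of_adj_sup hc ha hb hc' hab.ne hac.symm hKbc.symm hcc' hw.1 hcw
    grind

theorem IsTrianglesMatching.exists_isProperOn [Finite V] (h : IsTrianglesMatching K M S) :
    ∃ f, IsProperOn (K ⊔ M) S f := by
  induction S using WellFoundedLT.induction generalizing M with | ind S ih
  by_cases hthree : ∀ v ∈ S, ∀ p q, ∃ w ∈ S, (K ⊔ M).Adj v w ∧ w ≠ p ∧ w ≠ q
  · obtain rfl | ⟨a, ha⟩ := S.eq_empty_or_nonempty
    · exact ⟨0, by simp [IsProperOn]⟩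
    obtain ⟨M', T, haT, h', hextend⟩ := h.exists_reduction ha hthree
    obtain ⟨f, hf⟩ := ih (S \ T) (Set.sdiff_ssubset_left_iff.2 ⟨a, ha, haT⟩) h'
    exact hextend f hf
  · push Not at hthree
    obtain ⟨v, hv, p, q, hpq⟩ := hthree
    obtain ⟨f, hf⟩ := ih (S \ {v}) (Set.sdiff_ssubset_left_iff.2 ⟨v, hv, rfl⟩)
      (h.mono Set.sdiff_subset)
    exact hf.exists_extend_vertex fun w hw hvw => or_iff_not_imp_left.2 (hpq w hw hvw)

/-- The vertices have degree at most three, those of degree three lie in triangles, and no four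
vertices are pairwise adjacent. -/
structure IsTriCubic (H : SimpleGraph V) : Prop where
  ndeg_le : ∀ v, ndeg H v ≤ 3
  exists_triangle : ∀ v, ndeg H v = 3 → ∃ a b, H.Adj v a ∧ H.Adj v b ∧ H.Adj a b
  not_adj : ∀ x y u w, H.Adj x y → H.Adj u x → H.Adj u y → H.Adj w x → H.Adj w y → ¬ H.Adj u w

theorem IsProperOn.exists_extend_diamond {x y u w u' w' : V}
    (hf : IsProperOn H (S \ {x, y, u, w}) f) (hux : u ≠ x) (hwx : w ≠ x)
    (huw : ¬ H.Adj u w) (hx : ∀ z ∈ S, H.Adj x z → z = y ∨ z = u ∨ z = w)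
    (hy : ∀ z ∈ S, H.Adj y z → z = x ∨ z = u ∨ z = w)
    (hu : ∀ z ∈ S, H.Adj u z → z = x ∨ z = y ∨ z = u')
    (hw : ∀ z ∈ S, H.Adj w z → z = x ∨ z = y ∨ z = w') :
    ∃ g, IsProperOn H S g := by
  have hsplit : S \ {x, y, u, w} = ((S \ {y}) \ {x}) \ {u, w} := by grind
  rw [hsplit] at hf
  obtain ⟨f₁, hf₁, -, huw₁⟩ := hf.exists_extend_independent (α := f u') (β := f w')
    (by simp [huw, mt SimpleGraph.Adj.symm huw]) (by grind)
  have hf₁uw : f₁ u = f₁ w := huw₁ u (by simp) w (by simp)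
  obtain ⟨f₂, hf₂, hf₂₁, -⟩ := hf₁.exists_extend_independent (α := f₁ u) (β := f₁ w)
    (by simp) (by grind)
  have hf₂uw : f₂ u = f₂ w := by rw [hf₂₁ u hux, hf₂₁ w hwx, hf₁uw]
  obtain ⟨f₃, hf₃, -⟩ := hf₂.exists_extend_independent (α := f₂ x) (β := f₂ u)
    (by simp) (by grind)
  exact ⟨f₃, hf₃⟩

/-- The edges of `H` that lie in a triangle. -/
def triangleEdges (H : SimpleGraph V) : SimpleGraph V where
  Adj u v := H.Adj u v ∧ ∃ w, H.Adj u w ∧ H.Adj v w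
  symm := ⟨fun _ _ ⟨huv, w, huw, hvw⟩ => ⟨huv.symm, w, hvw, huw⟩⟩

theorem isTrianglesMatching_triangleEdges [Finite V] (hS : ∀ v ∈ S, ndeg H v = 3)
    (htri : ∀ v ∈ S, ∃ a b, H.Adj v a ∧ H.Adj v b ∧ H.Adj a b)
    (hdiamond : ∀ x ∈ S, ∀ y u w, H.Adj x y → H.Adj u x → H.Adj u y → H.Adj w x → H.Adj w y →
      u = w) :
    IsTrianglesMatching (triangleEdges H) (H \ triangleEdges H) S := by
  have hnbrs : ∀ v ∈ S, ∃ a b c, H.Adj a b ∧ (triangleEdges H).Adj v a ∧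
      (triangleEdges H).Adj v b ∧ ¬ (triangleEdges H).Adj v c ∧
      ∀ w, H.Adj v w → w = a ∨ w = b ∨ w = c := by
    intro v hv
    obtain ⟨a, b, ha, hb, hab⟩ := htri v hv
    obtain ⟨c, hc, hca, hcb⟩ := exists_adj_ne_ne_of_three_le_ndeg (hS v hv).ge a b
    have hnbr : ∀ w, H.Adj v w → w = a ∨ w = b ∨ w = c := fun w =>
      eq_or_eq_or_eq_of_ndeg_le_three (hS v hv).le ha hb hc hab.ne hca.symm hcb.symm
    refine ⟨a, b, c, hab, ⟨ha, b, hb, hab⟩, ⟨hb, a, ha, hab.symm⟩, ?_, hnbr⟩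
    rintro ⟨-, z, hvz, hcz⟩
    obtain rfl | rfl | rfl := hnbr z hvz
    · exact hcb.symm (hdiamond v hv z b c ha hb.symm hab.symm hc.symm hcz)
    · exact hca.symm (hdiamond v hv z a c hb ha.symm hab hc.symm hcz)
    · exact hcz.ne rfl
  refine ⟨fun v hv => ?_, fun u _ v hv w _ huv hvw huw => ?_, fun u hu v hv w hw huv huw => ?_⟩
  · obtain ⟨a, b, c, -, -, -, hvc, hnbr⟩ := hnbrs v hv
    refine ⟨a, b, fun w _ hvw => ?_⟩
    have := hnbr w hvw.1
    grind
  · obtain ⟨a, b, c, hab, -, -, hvc, hnbr⟩ := hnbrs v hv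
    have hadj : H.Adj u w := by
      have huc : u ≠ c := fun h => hvc (h ▸ huv.symm)
      have hwc : w ≠ c := fun h => hvc (h ▸ hvw)
      obtain rfl | rfl := (or_assoc.2 (hnbr u huv.1.symm)).resolve_right huc <;>
        obtain rfl | rfl := (or_assoc.2 (hnbr w hvw.1)).resolve_right hwc
      exacts [absurd rfl huw, hab, hab.symm, absurd rfl huw]
    exact ⟨hadj, v, huv.1, hvw.1.symm⟩
  · obtain ⟨a, b, c, hab, hua, hub, -, hnbr⟩ := hnbrs u hu
    rw [SimpleGraph.sdiff_adj] at huv huw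
    grind

theorem IsTriCubic.exists_isProperOn [Finite V] (hH : IsTriCubic H) (S : Set V) :
    ∃ f, IsProperOn H S f := by
  induction S using WellFoundedLT.induction with | ind S ih
  by_cases hthree : ∀ v ∈ S, ∀ p q, ∃ w ∈ S, H.Adj v w ∧ w ≠ p ∧ w ≠ q
  · have hclosed : ∀ v ∈ S, ndeg H v = 3 ∧ ∀ w, H.Adj v w → w ∈ S := by
      intro v hv
      obtain ⟨a, ha, hva, -⟩ := hthree v hv v v
      obtain ⟨b, hb, hvb, hba, -⟩ := hthree v hv a a
      obtain ⟨c, hc, hvc, hca, hcb⟩ := hthree v hv a b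
      refine ⟨(hH.ndeg_le v).antisymm (three_le_ndeg hva hvb hvc hba.symm hca.symm hcb.symm),
        fun w hvw => ?_⟩
      obtain rfl | rfl | rfl := eq_or_eq_or_eq_of_ndeg_le_three (hH.ndeg_le v) hva hvb hvc
        hba.symm hca.symm hcb.symm hvw <;> assumption
    have hthird : ∀ v ∈ S, ∀ a b, a ≠ b → H.Adj v a → H.Adj v b → ∃ c, ∀ w, H.Adj v w →
        w = a ∨ w = b ∨ w = c := by
      intro v hv a b hab hva hvb
      obtain ⟨c, -, hvc, hca, hcb⟩ := hthree v hv a b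
      exact ⟨c, fun w => eq_or_eq_or_eq_of_ndeg_le_three (hH.ndeg_le v) hva hvb hvc hab
        hca.symm hcb.symm⟩
    by_cases hdiamond : ∀ x ∈ S, ∀ y u w, H.Adj x y → H.Adj u x → H.Adj u y → H.Adj w x →
        H.Adj w y → u = w
    · have hTM := isTrianglesMatching_triangleEdges (fun v hv => (hclosed v hv).1)
        (fun v hv => hH.exists_triangle v (hclosed v hv).1) hdiamond
      obtain ⟨f, hf⟩ := hTM.exists_isProperOn
      exact ⟨f, by rwa [sup_sdiff_cancel_right fun _ _ h => h.1] at hf⟩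
    · push Not at hdiamond
      obtain ⟨x, hx, y, u, w, hxy, hux, huy, hwx, hwy, huw⟩ := hdiamond
      obtain ⟨u', hu'⟩ := hthird u ((hclosed x hx).2 u hux.symm) x y hxy.ne hux huy
      obtain ⟨w', hw'⟩ := hthird w ((hclosed x hx).2 w hwx.symm) x y hxy.ne hwx hwy
      obtain ⟨f, hf⟩ := ih (S \ {x, y, u, w}) (Set.sdiff_ssubset_left_iff.2 ⟨x, hx, by simp⟩)
      exact hf.exists_extend_diamond hux.ne hwx.ne (hH.not_adj x y u w hxy hux huy hwx hwy)
        (fun z _ => eq_or_eq_or_eq_of_ndeg_le_three (hH.ndeg_le x) hxy hux.symm hwx.symm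
          huy.ne.symm hwy.ne.symm huw)
        (fun z _ => eq_or_eq_or_eq_of_ndeg_le_three (hH.ndeg_le y) hxy.symm huy.symm hwy.symm
          hux.ne.symm hwx.ne.symm huw) (fun z _ => hu' z) (fun z _ => hw' z)
  · push Not at hthree
    obtain ⟨v, hv, p, q, hpq⟩ := hthree
    obtain ⟨f, hf⟩ := ih (S \ {v}) (Set.sdiff_ssubset_left_iff.2 ⟨v, hv, rfl⟩)
    exact hf.exists_extend_vertex fun w hw hvw => or_iff_not_imp_left.2 (hpq w hw hvw)

end Coloring

section LinkGraph

variable {V : Type*} {G : SimpleGraph V} {u w a b x y z : V}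

/-- The graph that joins two distinct vertices of degree three whenever they are the ends of a path
of `G` through vertices of degree two. -/
def linkGraph (G : SimpleGraph V) : SimpleGraph V where
  Adj u w := u ≠ w ∧ ndeg G u = 3 ∧ ndeg G w = 3 ∧
    ∃ x y k, G.Adj u x ∧ DartWalk G k (u, x) (y, w)
  symm := ⟨fun _ _ ⟨hne, hu, hw, x, y, k, hux, hwalk⟩ =>
    ⟨hne.symm, hw, hu, y, x, k, (hwalk.adj hux).symm, hwalk.swap⟩⟩
  loopless := ⟨fun _ h => h.1 rfl⟩

theorem linkGraph_adj_of_adj (h : G.Adj u w) (hu : ndeg G u = 3) (hw : ndeg G w = 3) :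
    (linkGraph G).Adj u w :=
  ⟨h.ne, hu, hw, w, u, 0, h, rfl⟩

theorem exists_injOn_firstStep (G : SimpleGraph V) (u : V) :
    ∃ φ : V → V, Set.InjOn φ ((linkGraph G).neighborSet u) ∧ ∀ w, (linkGraph G).Adj u w →
      ndeg G w = 3 ∧ G.Adj u (φ w) ∧ ∃ y k, DartWalk G k (u, φ w) (y, w) := by
  have hlink : ∀ w, ∃ x, (linkGraph G).Adj u w →
      ndeg G w = 3 ∧ G.Adj u x ∧ ∃ y k, DartWalk G k (u, x) (y, w) := by
    intro w
    by_cases h : (linkGraph G).Adj u w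
    · obtain ⟨-, -, hw, x, y, k, hux, hwalk⟩ := h
      exact ⟨x, fun _ => ⟨hw, hux, y, k, hwalk⟩⟩
    · exact ⟨u, fun h' => absurd h' h⟩
  choose φ hφ using hlink
  refine ⟨φ, fun w hw w' hw' heq => ?_, hφ⟩
  obtain ⟨hw3, -, y, k, hwalk⟩ := hφ w hw
  obtain ⟨hw3', -, y', k', hwalk'⟩ := hφ w' hw'
  rw [heq] at hwalk
  exact congrArg Prod.snd (hwalk.unique_end (by simp [hw3]) hwalk' (by simp [hw3'])).2

theorem ndeg_linkGraph_le [Finite V] (u : V) : ndeg (linkGraph G) u ≤ ndeg G u := by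
  obtain ⟨φ, hinj, hφ⟩ := exists_injOn_firstStep G u
  exact Set.ncard_le_ncard_of_injOn φ (fun w hw => (hφ w hw).2.1) hinj (Set.toFinite _)

theorem exists_distinct_walks_of_ndeg_linkGraph [Finite V]
    (hu : ndeg G u ≤ ndeg (linkGraph G) u) (hx : G.Adj u x) (hy : G.Adj u y) (hxy : x ≠ y) :
    ∃ w w' d d' k k', w ≠ w' ∧ w ≠ u ∧ ndeg G w = 3 ∧ ndeg G w' = 3 ∧
      DartWalk G k (u, x) (d, w) ∧ DartWalk G k' (u, y) (d', w') := by
  obtain ⟨φ, hinj, hφ⟩ := exists_injOn_firstStep G u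
  have himg : φ '' (linkGraph G).neighborSet u = G.neighborSet u := by
    refine Set.eq_of_subset_of_ncard_le ?_ (by rwa [hinj.ncard_image]) (Set.toFinite _)
    rintro _ ⟨w, hw, rfl⟩
    exact (hφ w hw).2.1
  obtain ⟨w, hw, rfl⟩ := himg.ge hx
  obtain ⟨w', hw', rfl⟩ := himg.ge hy
  obtain ⟨hw3, -, d, k, hwalk⟩ := hφ w hw
  obtain ⟨hw3', -, d', k', hwalk'⟩ := hφ w' hw'
  exact ⟨w, w', d, d', k, k', fun h => hxy (h ▸ rfl), hw.1.symm, hw3, hw3', hwalk, hwalk'⟩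

-- If `a` had degree two, then the path that starts with `u, a, b` would return to `u` or would end
-- in `b`, which is also the end of the path that starts with `u, b`.
theorem ndeg_eq_three_of_triangle [Finite V] (hu : ndeg (linkGraph G) u = 3)
    (hu3 : ndeg G u = 3) (ha : G.Adj u a) (hb : G.Adj u b) (hab : G.Adj a b) :
    ndeg G a = 3 := by
  obtain ⟨w, w', d, d', k, k', hne, hwu, hw, hw', hwalk, hwalk'⟩ :=
    exists_distinct_walks_of_ndeg_linkGraph (by rw [hu, hu3]) ha hb hab.ne
  have hw2 : ndeg G w ≠ 2 := by simp [hw]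
  have hw2' : ndeg G w' ≠ 2 := by simp [hw']
  have hunique : ∀ l e, DartWalk G l (u, a) e → ndeg G e.2 ≠ 2 → e.2 = w := fun l e he he2 =>
    congrArg Prod.snd (he.unique_end he2 hwalk hw2).2
  by_cases ha2 : ndeg G a = 2
  · have hstep : DartStep G (u, a) (a, b) := ⟨rfl, ha, hab, hb.ne.symm, ha2⟩
    by_cases hb2 : ndeg G b = 2
    · have hstep' : DartStep G (a, b) (b, u) := ⟨rfl, hab, hb.symm, ha.ne, hb2⟩
      exact absurd (hunique 2 _ (hstep.dartWalk.snoc hstep') (by simp [hu3])).symm hwu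
    · have hbw : b = w := hunique 1 _ hstep.dartWalk hb2
      have hbw' : b = w' :=
        congrArg Prod.snd (DartWalk.unique_end (k := 0) rfl hb2 hwalk' hw2').2
      exact absurd (hbw.symm.trans hbw') hne
  · rw [show a = w from hunique 0 _ rfl ha2, hw]

theorem IsTame.exists_triangle_of_ndeg_linkGraph [Finite V] (hG : IsTame G)
    (hu : ndeg (linkGraph G) u = 3) : ∃ a b, G.Adj u a ∧ G.Adj u b ∧ G.Adj a b ∧
      (linkGraph G).Adj u a ∧ (linkGraph G).Adj u b ∧ (linkGraph G).Adj a b := by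
  have hu3 : ndeg G u = 3 := (hG.ndeg_le u).antisymm (hu ▸ ndeg_linkGraph_le u)
  obtain ⟨a, b, ha, hb, hab⟩ := hG.exists_triangle u hu3
  have ha3 := ndeg_eq_three_of_triangle hu hu3 ha hb hab
  have hb3 := ndeg_eq_three_of_triangle hu hu3 hb ha hab.symm
  exact ⟨a, b, ha, hb, hab, linkGraph_adj_of_adj ha hu3 ha3, linkGraph_adj_of_adj hb hu3 hb3,
    linkGraph_adj_of_adj hab ha3 hb3⟩

theorem ThreadCondition.not_linkGraph_adj (hB : ThreadCondition G) (hG : IsTame G)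
    (hab : G.Adj a b) (hua : G.Adj u a) (hub : G.Adj u b) (hwa : G.Adj w a) (hwb : G.Adj w b) :
    ¬ (linkGraph G).Adj u w := by
  rintro ⟨hne, hu, hw, x, y, k, hux, hwalk⟩
  exact hG.not_dvd u x y w k hne hu hw hux hwalk
    (hB u x y w k hux hwalk (.inr ⟨a, b, hab, hua, hub, hwa, hwb⟩))

theorem IsTame.isTriCubic_linkGraph [Finite V] (hG : IsTame G) (hB : ThreadCondition G) :
    IsTriCubic (linkGraph G) := by
  have hle : ∀ v, ndeg (linkGraph G) v ≤ 3 := fun v => (ndeg_linkGraph_le v).trans (hG.ndeg_le v)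
  -- Two triangles of `G` on the vertices of a `K₄` of the link graph share an edge.
  have htriangle : ∀ v x y z, (linkGraph G).Adj v x → (linkGraph G).Adj v y →
      (linkGraph G).Adj v z → x ≠ y → x ≠ z → y ≠ z →
      (G.Adj v x ∧ G.Adj v y ∧ G.Adj x y) ∨ (G.Adj v x ∧ G.Adj v z ∧ G.Adj x z) ∨
        (G.Adj v y ∧ G.Adj v z ∧ G.Adj y z) := by
    intro v x y z hx hy hz hxy hxz hyz
    obtain ⟨a, b, ha, hb, hab, hla, hlb, -⟩ := hG.exists_triangle_of_ndeg_linkGraph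
      ((hle v).antisymm (three_le_ndeg hx hy hz hxy hxz hyz))
    have hmem := fun d => eq_or_eq_or_eq_of_ndeg_le_three (hle v) hx hy hz hxy hxz hyz (d := d)
    have := hab.ne
    have := hab.symm
    grind
  refine ⟨hle, fun v hv => ?_, fun x y u w hxy hux huy hwx hwy huw => ?_⟩
  · obtain ⟨a, b, -, -, -, ha, hb, hab⟩ := hG.exists_triangle_of_ndeg_linkGraph hv
    exact ⟨a, b, ha, hb, hab⟩
  · have hdiamond := fun a b u w => hB.not_linkGraph_adj hG (a := a) (b := b) (u := u) (w := w)
    have hsymm : ∀ a b, G.Adj a b → G.Adj b a := fun _ _ h => h.symm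
    have hlsymm : ∀ a b, (linkGraph G).Adj a b → (linkGraph G).Adj b a := fun _ _ h => h.symm
    have := htriangle x y u w hxy hux.symm hwx.symm huy.ne.symm hwy.ne.symm huw.ne
    have := htriangle y x u w hxy.symm huy.symm hwy.symm hux.ne.symm hwx.ne.symm huw.ne
    have := htriangle u w x y huw hux huy hwx.ne hwy.ne hxy.ne
    have := htriangle w u x y huw.symm hwx hwy hux.ne huy.ne hxy.ne
    grind

end LinkGraph

section Orientation

open Relation

variable {V : Type*} {G : SimpleGraph V} {c g : V → ZMod 3} {h : V × V → ZMod 3}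
  {B P : V × V → Prop} {d e f : V × V} {u v w : V} {k l : ℕ}

theorem DartWalk.comparable (hk : DartWalk G k d e) (hl : DartWalk G l d f) :
    (∃ m, DartWalk G m e f) ∨ ∃ m, DartWalk G m f e := by
  wlog hkl : k ≤ l generalizing k l e f
  · exact (this hl hk (le_of_not_ge hkl)).symm
  obtain ⟨m, rfl⟩ := Nat.exists_eq_add_of_le hkl
  obtain ⟨e', hwalk, hwalk'⟩ := hl.exists_split
  cases hk.unique hwalk
  exact .inl ⟨m, hwalk'⟩

theorem exists_dartWalk_of_eqvGen (hde : EqvGen (DartStep G) d e) :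
    (∃ k, DartWalk G k d e) ∨ ∃ k, DartWalk G k e d := by
  induction hde with
  | rel d e hstep => exact .inl ⟨1, hstep.dartWalk⟩
  | refl d => exact .inl ⟨0, rfl⟩
  | symm d e _ ih => exact ih.symm
  | trans d e f _ _ ih ih' =>
    obtain ⟨k, hk⟩ | ⟨k, hk⟩ := ih <;> obtain ⟨l, hl⟩ | ⟨l, hl⟩ := ih'
    · exact .inl ⟨_, hk.trans hl⟩
    · obtain ⟨m, hm⟩ | ⟨m, hm⟩ := hk.swap.comparable hl.swap
      exacts [.inr ⟨m, hm.swap⟩, .inl ⟨m, hm.swap⟩]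
    · exact hk.comparable hl
    · exact .inr ⟨_, hl.trans hk⟩

theorem exists_dartWalk_of_eqvGen_of_not_dartStep (hde : EqvGen (DartStep G) d e)
    (hd : ∀ f, ¬ DartStep G f d) : ∃ k, DartWalk G k d e := by
  obtain hk | ⟨_ | k, hk⟩ := exists_dartWalk_of_eqvGen hde
  · exact hk
  · exact ⟨0, hk.symm⟩
  · obtain ⟨_, _, hstep⟩ := hk.exists_snoc
    exact absurd hstep (hd _)

theorem exists_first_or_cycle [Finite V] (d : V × V) :
    (∃ b k, (∀ f, ¬ DartStep G f b) ∧ DartWalk G k b d) ∨ ∃ k, 0 < k ∧ DartWalk G k d d := by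
  refine or_iff_not_imp_left.2 fun hfirst => ?_
  have hback : ∀ k, ∃ e, DartWalk G k e d := by
    intro k
    induction k with
    | zero => exact ⟨d, rfl⟩
    | succ k ih =>
      obtain ⟨e, he⟩ := ih
      obtain ⟨f, hf⟩ : ∃ f, DartStep G f e := by
        by_contra! hno
        exact hfirst ⟨e, k, hno, he⟩
      exact ⟨f, e, hf, he⟩
  choose e he using hback
  obtain ⟨i, j, hij, heq⟩ :=
    Set.finite_univ.exists_lt_map_eq_of_forall_mem (f := e) fun _ => Set.mem_univ _
  obtain ⟨m, rfl⟩ := Nat.exists_eq_add_of_lt hij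
  obtain ⟨d', hd', hwalk⟩ := (show DartWalk G (i + (m + 1)) _ d from he (i + m + 1)).exists_split
  cases hd'.unique (heq ▸ he i)
  exact ⟨m + 1, m.succ_pos, hwalk⟩

theorem DartWalk.iterate (hk : DartWalk G k d d) (l : ℕ) : DartWalk G (l * k) d d := by
  induction l with
  | zero => simp [DartWalk]
  | succ l ih => simpa only [Nat.succ_mul] using ih.trans hk

theorem DartWalk.eqvGen (hk : DartWalk G k d e) : EqvGen (DartStep G) d e := by
  induction k generalizing d with
  | zero => exact hk ▸ .refl d
  | succ k ih =>
    obtain ⟨d', hstep, hwalk⟩ := hk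
    exact .trans _ _ _ (.rel _ _ hstep) (ih hwalk)

theorem exists_dartWalk_from_base [Finite V] (d : V × V) :
    ∃ b, ∀ e, EqvGen (DartStep G) d e → ∃ k, DartWalk G k b e := by
  obtain ⟨b, k, hb, hbd⟩ | ⟨k, hk, hcycle⟩ := exists_first_or_cycle (G := G) d
  · exact ⟨b, fun e hde =>
      exists_dartWalk_of_eqvGen_of_not_dartStep (.trans _ _ _ hbd.eqvGen hde) hb⟩
  · refine ⟨d, fun e hde => (exists_dartWalk_of_eqvGen hde).elim id ?_⟩
    rintro ⟨l, hl⟩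
    obtain ⟨m, hm⟩ := Nat.exists_eq_add_of_le (Nat.le_mul_of_pos_right l hk)
    obtain ⟨f, hdf, hfd⟩ := (show DartWalk G (m + l) d d by
      rw [add_comm, ← hm]; exact hcycle.iterate l).exists_split
    obtain rfl : e = f := Prod.swap_injective (hl.swap.unique hfd.swap)
    exact ⟨m, hdf⟩

theorem DartWalk.cast_eq {n : ℕ} (hcycle : ∀ d k, DartWalk G k d d → n ∣ k)
    (hk : DartWalk G k d e) (hl : DartWalk G l d e) : (k : ZMod n) = l := by
  wlog hkl : k ≤ l generalizing k l
  · exact (this hl hk (le_of_not_ge hkl)).symm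
  obtain ⟨m, rfl⟩ := Nat.exists_eq_add_of_le hkl
  obtain ⟨e', hwalk, hwalk'⟩ := hl.exists_split
  cases hk.unique hwalk
  rw [Nat.cast_add, (ZMod.natCast_eq_zero_iff m n).2 (hcycle _ _ hwalk'), add_zero]

theorem exists_dartPotential [Finite V] {n : ℕ} (hcycle : ∀ d k, DartWalk G k d d → n ∣ k)
    (c : V × V → ZMod n) : ∃ h : V × V → ZMod n,
      (∀ d e, DartStep G d e → h e = h d + 1) ∧ ∀ d, (∀ f, ¬ DartStep G f d) → h d = c d := by
  choose base hbase using fun q : Quot (DartStep G) => exists_dartWalk_from_base (G := G) q.out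
  have hwalk : ∀ d, ∃ k, DartWalk G k (base (Quot.mk _ d)) d := fun d =>
    hbase _ d (Quot.eqvGen_exact (Quot.out_eq _))
  choose dist hdist using hwalk
  refine ⟨fun d => c (base (Quot.mk _ d)) + dist d, fun d e hde => ?_, fun d hd => ?_⟩
  · have hd := (hdist d).snoc hde
    dsimp only
    rw [Quot.sound hde] at hd ⊢
    rw [add_assoc, ← Nat.cast_succ, (hdist e).cast_eq hcycle hd]
  · have hd0 := hdist d
    dsimp only
    generalize dist d = k at hd0 ⊢
    cases k with
    | zero => simp [show base _ = d from hd0]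
    | succ k =>
      obtain ⟨_, -, hstep⟩ := hd0.exists_snoc
      exact absurd hstep (hd _)

theorem apply_of_dartWalk {n : ℕ} {h : V × V → ZMod n}
    (hh : ∀ d e, DartStep G d e → h e = h d + 1) (hk : DartWalk G k d e) : h e = h d + k := by
  induction k generalizing d with
  | zero => simp [show d = e from hk]
  | succ k ih =>
    obtain ⟨d', hstep, hwalk⟩ := hk
    rw [ih hwalk, hh d d' hstep, Nat.cast_succ]
    ring

/-- An orientation of the edges that is constant along threads: `P (u, v)` says that the edge `uv`
is directed towards `v`. -/
structure IsOrientation (G : SimpleGraph V) (P : V × V → Prop) : Prop where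
  iff_of_dartStep : ∀ d e, DartStep G d e → (P d ↔ P e)
  swap_iff : ∀ u v, G.Adj u v → (P (v, u) ↔ ¬ P (u, v))

theorem quot_mk_ne_swap (hd : G.Adj d.1 d.2) :
    Quot.mk (DartStep G) d ≠ Quot.mk (DartStep G) d.swap := by
  intro heq
  obtain ⟨k, hk⟩ | ⟨k, hk⟩ := exists_dartWalk_of_eqvGen (Quot.eqvGen_exact heq)
  · exact not_dartWalk_swap hd hk
  · exact not_dartWalk_swap (d := d.swap) hd.symm (by rwa [Prod.swap_swap])

theorem exists_isOrientation (hB : ∀ d e, DartStep G d e → (B d ↔ B e))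
    (hswap : ∀ d, B d → ¬ B d.swap) :
    ∃ P, IsOrientation G P ∧ ∀ d, P d → ¬ B d := by
  -- A thread with a free choice is directed by comparing its two direction classes.
  refine ⟨fun d => ¬ B d ∧ (B d.swap ∨
    WellOrderingRel (Quot.mk (DartStep G) d) (Quot.mk (DartStep G) d.swap)),
    ⟨fun d e hde => ?_, fun u v huv => ?_⟩, fun d hd => hd.1⟩
  · rw [hB d e hde, hB _ _ hde.swap, Quot.sound hde, Quot.sound hde.swap]
  · have := hswap (u, v)
    have hne := quot_mk_ne_swap (d := (u, v)) huv
    have := asymm_of (WellOrderingRel (α := Quot (DartStep G))) (a := Quot.mk _ (u, v))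
      (b := Quot.mk _ (v, u))
    have := (trichotomous_of (WellOrderingRel (α := Quot (DartStep G))) (Quot.mk _ (u, v))
      (Quot.mk _ (v, u)))
    simp only [Prod.swap_prod_mk] at *
    tauto

/-- The thread of `d` leads to a vertex of degree three whose colour under `c` differs from the one
that `h` prescribes there. -/
def HasConflict (G : SimpleGraph V) (c : V → ZMod 3) (h : V × V → ZMod 3) (d : V × V) : Prop :=
  ∃ e, EqvGen (DartStep G) d e ∧ G.Adj e.1 e.2 ∧ ndeg G e.2 = 3 ∧ c e.2 ≠ h e

theorem HasConflict.iff_of_dartStep (hde : DartStep G d e) :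
    HasConflict G c h d ↔ HasConflict G c h e :=
  ⟨fun ⟨f, hf, hconf⟩ => ⟨f, .trans _ _ _ (.symm _ _ (.rel _ _ hde)) hf, hconf⟩,
    fun ⟨f, hf, hconf⟩ => ⟨f, .trans _ _ _ (.rel _ _ hde) hf, hconf⟩⟩

theorem not_dartStep_of_ndeg_ne_two (hd : ndeg G d.1 ≠ 2) (f : V × V) : ¬ DartStep G f d :=
  fun hstep => hd (hstep.fst_eq ▸ hstep.ndeg_eq)

theorem eqvGen_swap (hde : EqvGen (DartStep G) d e) : EqvGen (DartStep G) d.swap e.swap := by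
  obtain ⟨k, hk⟩ | ⟨k, hk⟩ := exists_dartWalk_of_eqvGen hde
  exacts [.symm _ _ hk.swap.eqvGen, hk.swap.eqvGen]

theorem HasConflict.not_swap (hG : IsTame G) (hT : ThreadCondition G)
    (hc : ∀ u w, (linkGraph G).Adj u w → c u ≠ c w)
    (hstep : ∀ d e, DartStep G d e → h e = h d + 1)
    (hfirst : ∀ d, (∀ f, ¬ DartStep G f d) → h d = c d.1 + 1)
    (hd : HasConflict G c h d) : ¬ HasConflict G c h d.swap := by
  have hlink : ∀ x y z : ZMod 3, x ≠ y → z ≠ 0 → y = x + z ∨ x = y + z := by decide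
  rintro ⟨⟨x, u⟩, hdx, hxu, hu, hconf'⟩
  obtain ⟨⟨y, w⟩, hdy, hyw, hw, hconf⟩ := hd
  have hdx' : EqvGen (DartStep G) d (u, x) := by simpa using eqvGen_swap hdx
  have hux := not_dartStep_of_ndeg_ne_two (G := G) (d := (u, x)) (by simp [hu])
  have hwy := not_dartStep_of_ndeg_ne_two (G := G) (d := (w, y)) (by simp [hw])
  obtain ⟨k, hwalk⟩ :=
    exists_dartWalk_of_eqvGen_of_not_dartStep (.trans _ _ _ (.symm _ _ hdx') hdy) hux
  have hyw' : h (y, w) = c u + (k + 1 : ℕ) := by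
    rw [apply_of_dartWalk hstep hwalk, hfirst _ hux, Nat.cast_succ]
    ring
  have hxu' : h (x, u) = c w + (k + 1 : ℕ) := by
    rw [apply_of_dartWalk hstep (e := (x, u)) hwalk.swap, hfirst (y, w).swap hwy, Nat.cast_succ]
    simp only [Prod.swap_prod_mk]
    ring
  by_cases huw : u = w
  · subst huw
    have hzero := (ZMod.natCast_eq_zero_iff _ 3).2 (hT u x y u k hxu.symm hwalk (.inl rfl))
    rw [hzero, add_zero] at hyw'
    exact hconf hyw'.symm
  · have hne : ((k + 1 : ℕ) : ZMod 3) ≠ 0 := fun hzero =>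
      hG.not_dvd u x y w k huw hu hw hxu.symm hwalk ((ZMod.natCast_eq_zero_iff _ 3).1 hzero)
    obtain heq | heq := hlink _ _ _ (hc u w ⟨huw, hu, hw, x, y, k, hxu.symm, hwalk⟩) hne
    · exact hconf (heq.trans hyw'.symm)
    · exact hconf' (heq.trans hxu'.symm)

theorem IsTame.dartStep [Finite V] (hG : IsTame G) (hv : ndeg G v ≠ 3) (hu : G.Adj u v)
    (hw : G.Adj v w) (hwu : w ≠ u) : DartStep G (u, v) (v, w) := by
  have := hG.ndeg_le v
  have := two_le_ndeg hw hu.symm hwu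
  exact ⟨rfl, hu, hw, hwu, by dsimp only; omega⟩

theorem IsOrientation.eq_of_head [Finite V] (hP : IsOrientation G P) (hG : IsTame G)
    (hv : ndeg G v ≠ 3) (hu : G.Adj u v) (hPu : P (u, v)) (hw : G.Adj w v) (hPw : P (w, v)) :
    w = u := by
  by_contra hwu
  have hstep := hG.dartStep hv hu hw.symm hwu
  exact (hP.swap_iff w v hw).1 ((hP.iff_of_dartStep _ _ hstep).1 hPu) hPw

theorem IsOrientation.exists_apply_eq_add_one [Finite V] (hP : IsOrientation G P) (hG : IsTame G)
    (hstep : ∀ d e, DartStep G d e → h e = h d + 1)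
    (hfirst : ∀ d, (∀ f, ¬ DartStep G f d) → h d = c d.1 + 1)
    (hthree : ∀ u v, G.Adj u v → P (u, v) → ndeg G v = 3 → c v = h (u, v)) :
    ∃ g : V → ZMod 3, ∀ u v, G.Adj u v → P (u, v) → g v = g u + 1 := by
  classical
  let g v := if hv : ∃ u, G.Adj u v ∧ P (u, v) then h (hv.choose, v) else c v
  have hhead : ∀ u v, G.Adj u v → P (u, v) → g v = h (u, v) := by
    intro u v huv hPuv
    have hv : ∃ u, G.Adj u v ∧ P (u, v) := ⟨u, huv, hPuv⟩
    obtain ⟨hadj, hPv⟩ := hv.choose_spec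
    simp only [g, dif_pos hv]
    by_cases hv3 : ndeg G v = 3
    · rw [← hthree _ v hadj hPv hv3, hthree u v huv hPuv hv3]
    · rw [hP.eq_of_head hG hv3 huv hPuv hadj hPv]
  refine ⟨g, fun u v huv hPuv => ?_⟩
  rw [hhead u v huv hPuv]
  by_cases hprev : ∃ t, DartStep G t (u, v)
  · obtain ⟨⟨t, u'⟩, ht⟩ := hprev
    obtain rfl : u = u' := ht.fst_eq
    rw [hstep _ _ ht, hhead t u ht.adj_left ((hP.iff_of_dartStep _ _ ht).2 hPuv)]
  · have hgu : g u = c u := by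
      by_cases hu : ∃ t, G.Adj t u ∧ P (t, u)
      · obtain ⟨t, htu, hPtu⟩ := hu
        have htv : v ≠ t := by
          rintro rfl
          exact (hP.swap_iff u v huv).1 hPtu hPuv
        have hu3 : ndeg G u = 3 := by
          by_contra hu3
          exact hprev ⟨_, hG.dartStep hu3 htu huv htv⟩
        rw [hhead t u htu hPtu, hthree t u htu hPtu hu3]
      · simp only [g, dif_neg hu]
    rw [hfirst _ (not_exists.1 hprev), hgu]

theorem IsOrientation.isDynamicThreeColoring (hP : IsOrientation G P)
    (hg : ∀ u v, G.Adj u v → P (u, v) → g v = g u + 1) : IsDynamicThreeColoring G g := by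
  have hne : ∀ a : ZMod 3, a ≠ a + 1 ∧ a ≠ a + 1 + 1 := by decide
  refine ⟨fun u v huv => ?_, fun v u w hv hu hw huw => ?_⟩
  · by_cases h : P (u, v)
    · rw [hg u v huv h]
      exact (hne _).1
    · rw [hg v u huv.symm ((hP.swap_iff u v huv).2 h)]
      exact (hne _).1.symm
  · have hstep : DartStep G (u, v) (v, w) := ⟨rfl, hu.symm, hw, huw.symm, hv⟩
    by_cases h : P (u, v)
    · rw [hg v w hw ((hP.iff_of_dartStep _ _ hstep).1 h), hg u v hu.symm h]
      exact (hne _).2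
    · have hvu := (hP.swap_iff u v hu.symm).2 h
      rw [hg v u hu hvu, hg w v hw.symm ((hP.iff_of_dartStep _ _ hstep.swap).2 hvu)]
      exact (hne _).2.symm

theorem IsTame.exists_isDynamicThreeColoring [Finite V] (hG : IsTame G) (hT : ThreadCondition G) :
    ∃ g : V → ZMod 3, IsDynamicThreeColoring G g := by
  obtain ⟨c, hc⟩ := (hG.isTriCubic_linkGraph hT).exists_isProperOn Set.univ
  obtain ⟨h, hstep, hfirst⟩ := exists_dartPotential (fun _ _ => hT.dvd_of_dartWalk_self)
    fun d => c d.1 + 1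
  obtain ⟨P, hP, hPconf⟩ := exists_isOrientation (B := HasConflict G c h)
    (fun _ _ => HasConflict.iff_of_dartStep) fun _ => HasConflict.not_swap hG hT
      (fun u w => hc u trivial w trivial) hstep hfirst
  obtain ⟨g, hg⟩ := hP.exists_apply_eq_add_one hG hstep hfirst fun u v huv hPuv hv => by
    by_contra hconf
    exact hPconf _ hPuv ⟨_, .refl _, huv, hv, hconf⟩
  exact ⟨g, hP.isDynamicThreeColoring hg⟩

end Orientation

theorem dynamicChromaticNumber_le_three_iff_threadCondition {V : Type} [Fintype V]
    {G : SimpleGraph V} (hG : InClassC G) : dynamicChromaticNumber G ≤ 3 ↔ ThreadCondition G := by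
  have htame := isTame_of_inClassC hG
  rw [dynamicChromaticNumber_le_three_iff fun v hv =>
    htame.exists_triangle v ((htame.ndeg_le v).antisymm hv)]
  exact ⟨fun ⟨_, hc⟩ => hc.threadCondition, htame.exists_isDynamicThreeColoring⟩

section Definability

variable {V : Type*} {G : SimpleGraph V} {ι : Type}

theorem ndeg_eq_two_iff {v : V} : ndeg G v = 2 ↔
    ∃ e : V × V, e.1 ≠ e.2 ∧ (G.Adj v e.1 ∧ G.Adj v e.2) ∧
      ¬∃ w, G.Adj v w ∧ ¬(w = e.1 ∨ w = e.2) := by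
  simp only [ndeg, Set.ncard_eq_two, Set.ext_iff, SimpleGraph.mem_neighborSet,
    Set.mem_insert_iff, Set.mem_singleton_iff, Prod.exists]
  refine exists_congr fun a => exists_congr fun b => and_congr_right fun _ => ⟨fun h => ?_, ?_⟩
  · simp [h]
  · rintro ⟨⟨ha, hb⟩, hall⟩ w
    refine ⟨fun hw => of_not_not fun hne => hall ⟨w, hw, hne⟩, ?_⟩
    rintro (rfl | rfl) <;> assumption

theorem polyDecidable_ndeg_eq_two (i : ι) : PolyDecidable fun _ G y => ndeg G (y i) = 2 :=
  (PolyDecidable.exists_pair (Q := fun _ G y e => e.1 ≠ e.2 ∧ (G.Adj (y i) e.1 ∧ G.Adj (y i) e.2) ∧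
      ¬∃ w, G.Adj (y i) w ∧ ¬(w = e.1 ∨ w = e.2))
    ((PolyDecidable.eq _ _).not.and <| ((PolyDecidable.adj _ _).and (.adj _ _)).and <|
      .not <| .exists_vertex (Q := fun _ G y w => G.Adj (y (some (some i))) w ∧
          ¬(w = y (some none) ∨ w = y none))
        ((PolyDecidable.adj _ _).and ((PolyDecidable.eq _ _).or (.eq _ _)).not))).congr
    fun _ _ _ => ndeg_eq_two_iff

theorem polyDecidable_dartStep (i j i' j' : ι) :
    PolyDecidable fun _ G y => DartStep G (y i, y j) (y i', y j') :=
  (PolyDecidable.eq _ _).and <| (PolyDecidable.adj _ _).and <| (PolyDecidable.adj _ _).and <|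
    (PolyDecidable.eq _ _).not.and <| polyDecidable_ndeg_eq_two _

theorem polyDecidable_dartWalk (k : ℕ) (i j i' j' : ι) :
    PolyDecidable fun _ G y => DartWalk G k (y i, y j) (y i', y j') := by
  induction k generalizing ι with
  | zero =>
    exact ((PolyDecidable.eq i i').and (.eq j j')).congr fun _ _ _ => Prod.ext_iff
  | succ k ih =>
    exact .exists_pair
      (Q := fun _ G y e => DartStep G (y i, y j) e ∧ DartWalk G k e (y i', y j'))
      ((polyDecidable_dartStep _ _ _ _).and (ih _ _ _ _))

theorem polyDecidable_forcedEqual (i j : ι) :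
    PolyDecidable fun _ G y => ForcedEqual G (y i) (y j) :=
  ((PolyDecidable.eq i j).or <| .exists_pair (Q := fun _ G y e => G.Adj e.1 e.2 ∧
      G.Adj (y i) e.1 ∧ G.Adj (y i) e.2 ∧ G.Adj (y j) e.1 ∧ G.Adj (y j) e.2)
    ((PolyDecidable.adj _ _).and <| (PolyDecidable.adj _ _).and <| (PolyDecidable.adj _ _).and <|
      (PolyDecidable.adj _ _).and (.adj _ _))).congr fun _ _ _ => by
    simp only [ForcedEqual, Prod.exists]

theorem exists_dartWalk_mul_iff {m : ℕ} {d e : V × V} :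
    (∃ k, DartWalk G (m * k) d e) ↔ Relation.ReflTransGen (DartWalk G m) d e := by
  constructor
  · rintro ⟨k, h⟩
    induction k generalizing d with
    | zero =>
      cases h
      rfl
    | succ k ih =>
      rw [Nat.mul_succ, add_comm] at h
      obtain ⟨f, hdf, hfe⟩ := h.exists_split
      exact (ih hfe).head hdf
  · intro h
    induction h with
    | refl => exact ⟨0, rfl⟩
    | tail _ hstep ih =>
      obtain ⟨k, hwalk⟩ := ih
      exact ⟨k + 1, hwalk.trans hstep⟩

theorem threadCondition_iff : ThreadCondition G ↔ ¬∃ d : V × V, G.Adj d.1 d.2 ∧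
    ∃ e, Relation.ReflTransGen (DartWalk G 3) d e ∧
      (ForcedEqual G d.1 e.2 ∨ ∃ f, DartStep G e f ∧ ForcedEqual G d.1 f.2) := by
  simp only [← exists_dartWalk_mul_iff]
  constructor
  · rintro hG ⟨⟨u, x⟩, hux, ⟨y, w⟩, ⟨k, hwalk⟩, hforced | ⟨⟨y', w'⟩, hstep, hforced⟩⟩
    · have := hG u x y w _ hux hwalk hforced
      lia
    · have := hG u x y' w' _ hux (hwalk.snoc hstep) hforced
      lia
  · intro hG u x y w k hux hwalk hforced
    by_contra hdvd
    obtain ⟨j, rfl | rfl⟩ : ∃ j, k = 3 * j ∨ k = 3 * j + 1 := ⟨k / 3, by lia⟩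
    · exact hG ⟨(u, x), hux, (y, w), ⟨j, hwalk⟩, .inl hforced⟩
    · obtain ⟨e, hwalk', hstep⟩ := hwalk.exists_snoc
      exact hG ⟨(u, x), hux, e, ⟨j, hwalk'⟩, .inr ⟨(y, w), hstep, hforced⟩⟩

theorem polyDecidable_threadCondition :
    PolyDecidable fun _ G (_ : Empty → Fin _) => ThreadCondition G := by
  let EndsForcedEqual (n : ℕ) (G : SimpleGraph (Fin n)) (d e : Fin n × Fin n) : Prop :=
    ForcedEqual G d.1 e.2 ∨ ∃ f, DartStep G e f ∧ ForcedEqual G d.1 f.2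
  have hends : PolyDecidable fun n G (y : Option (Option (Option (Option Empty))) → Fin n) =>
      EndsForcedEqual n G (y (some (some (some none))), y (some (some none)))
        (y (some none), y none) :=
    (polyDecidable_forcedEqual _ _).or <| .exists_pair
      (Q := fun _ G y f => DartStep G (y (some none), y none) f ∧
        ForcedEqual G (y (some (some (some none)))) f.2)
      ((polyDecidable_dartStep _ _ _ _).and (polyDecidable_forcedEqual _ _))
  have hreach := PolyDecidable.reflTransGen (R := fun _ G => DartWalk G 3)
    (P := fun n G y e => EndsForcedEqual n G (y (some none), y none) e)
    (fun _ _ _ _ _ => DartWalk.unique) (polyDecidable_dartWalk 3 0 1 2 3) hends (some none) none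
  exact (PolyDecidable.exists_pair (Q := fun n G _ d => G.Adj d.1 d.2 ∧
    ∃ e, Relation.ReflTransGen (DartWalk G 3) d e ∧ EndsForcedEqual n G d e)
    ((PolyDecidable.adj _ _).and hreach)).not.congr fun _ _ _ => threadCondition_iff

end Definability

end DynamicColoring

theorem theorem5 :
    PolynomiallySolvableOn (fun G => InClassC G.2) (fun G => dynamicChromaticNumber G.2 ≤ 3) := by
  open DynamicColoring in
  exact (polyDecidable_threadCondition.polynomiallySolvableOn _).congr fun _ hG =>
    dynamicChromaticNumber_le_three_iff_threadCondition hG
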